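/- Let $\mathbb K\in\{\mathbb R,\mathbb C\}$, let $I$ be a nonempty set, and write $\overline{\mathbb R}=\mathbb R\cup\{\infty\}$, $\overline{\mathbb N}=\mathbb N\cup\{\infty\}$ (with $0\in\mathbb N$). \textbf{Weighted restricted products.} Let $(X_i)_{i\in I}$, $(Y_i)_{i\in I}$ be families of normed spaces over $\mathbb K$, let $O_i\subseteq X_i$ be open and nonempty, let $\mathcal W$ be a nonempty set of functions $f:\bigsqcup_{i}O_i\to\overline{\mathbb R}$ ("weights"), write $f_i=f|_{O_i}$, and let $k\in\overline{\mathbb N}$. For families $\phi=(\phi_i)_{i\in I}$ of maps $\phi_i:O_i\to Y_i$ that are $k$ times continuously Fréchet differentiable over $\mathbb K$, $f\in\mathcal W$ and $\ell\in\mathbb N$ with $\ell\le k$, put $$\|\phi\|_{f,\ell}=\sup_{i\in I}\ \sup_{x\in O_i}|f_i(x)|\,\|D^{\ell}\phi_i(x)\|_{op}\in[0,\infty]\qquad(\infty\cdot 0=0).$$ Let $C^k_{\mathcal W}(O_i,Y_i)_{i\in I}$ be the vector space of all such $\phi$ with $\|\phi\|_{f,\ell}<\infty$ for all $f\in\mathcal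 W$ and all $\ell\in\mathbb N$ with $\ell\le k$, endowed with the locally convex topology defined by these seminorms. \textbf{Differentiability.} Let $E,F$ be locally convex spaces over $\mathbb K$ and $Q\subseteq E$ open and nonempty. A map $f:Q\to F$ is $C^0$ if it is continuous. For $n\ge1$ it is $C^n$ if it is continuous, $df(u,x)=\lim_{t\to0,\,t\ne0}t^{-1}(f(u+tx)-f(u))$ (with $t\in\mathbb K$) exists for all $u\in Q$, $x\in E$, and $df:Q\times E\to F$ is continuous and $C^{n-1}$. It is $C^\infty$ if it is $C^n$ for all $n\in\mathbb N$. \textbf{Proposition (simultaneous composition).} For each $i\in I$ let $U_i,V_i,W_i$ be open nonempty subsets of a normed space $X_i$ with $U_i+V_i\subseteq W_i$ and $V_i$ balanced (so $0\in V_i$ and $U_i\subseteq W_i$), and let $Y_i$ be a normed space. Let $\mathcal W\subseteq\overline{\mathbb R}^{\,\bigsqcup_i W_i}$ contain an adjusting weight $\omega$ for $(V_i)_{i\in I}$, i.e. a function $\omega:\bigsqcup_iW_i\to\mathbb R$ such that for each $i\in I$ $$\sup_{x\in W_i}|\omega_i(x)|<\infty\quad\text{and}\quad\inf_{x\in W_i}|\omega_i(x)|\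 \ge\ \max\Bigl(\frac1{\operatorname{dist}(0,\partial V_i)},\,1\Bigr),$$ where $\operatorname{dist}(0,\emptyset)=\infty$ and $1/\infty=0$. Over the sets $U_i$, use the restrictions of the weights in $\mathcal W$ to $\bigsqcup_iU_i$. Let $k,\ell\in\overline{\mathbb N}$ and $$\Omega=\Bigl\{(\eta_i)_i\in C^k_{\mathcal W}(U_i,X_i)_{i\in I}\ :\ (\exists r>0)(\forall i\in I,\ x\in U_i)\ \ \eta_i(x)+B_{X_i}\bigl(0,\tfrac r{|\omega_i(x)|}\bigr)\subseteq V_i\Bigr\},$$ where $B_{X_i}(0,s)$ is the open ball of radius $s$. Then $\Omega$ is open and nonempty in $C^k_{\mathcal W}(U_i,X_i)_{i\in I}$, and the map $$C^{k+\ell+1}_{\mathcal W}(W_i,Y_i)_{i\in I}\times\Omega\ \to\ C^k_{\mathcal W}(U_i,Y_i)_{i\in I},\qquad\bigl((\gamma_i)_i,(\eta_i)_i\bigr)\mapsto\bigl(\gamma_i\circ(\eta_i+\mathrm{id}_{U_i})\bigr)_i$$ is defined (all the compositions make sense, and the resulting family lies in $C^k_{\mathcal W}(U_i,Y_i)_{i\in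 I}$) and is $C^\ell$. -/

import Mathlib

open Set Filter Topology
open scoped ENNReal

noncomputable section

namespace WeightedProd

universe u v

/-! ### Keller's `C^n_c`-calculus -/

/-- `f` is of class `C^n` (in the sense of Keller's `C^n_c`-theory) on the open subset `U` of the
locally convex `𝕜`-vector space `E`: `C^0` means continuous, and `f` is `C^(n+1)` if `f` is
continuous, all directional derivatives
`df (u, x) = lim_{t → 0, t ≠ 0} t⁻¹ (f (u + t x) - f u)` (`u ∈ U`, `x ∈ E`, `t ∈ 𝕜`) exist,
and `df : U × E → F` is continuous and of class `C^n`. Only the values of `f` on `U` matter. -/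
def KellerCNat (𝕜 : Type*) [RCLike 𝕜] {F : Type v} [AddCommGroup F] [Module 𝕜 F]
    [TopologicalSpace F] :
    ℕ → ∀ {E : Type u} [AddCommGroup E] [Module 𝕜 E] [TopologicalSpace E],
      (E → F) → Set E → Prop
  | 0, _, _, _, _, f, U => ContinuousOn f U
  | n + 1, E, _, _, _, f, U =>
      ContinuousOn f U ∧
      ∃ df : E × E → F,
        (∀ u ∈ U, ∀ x : E,
          Tendsto (fun t : 𝕜 => t⁻¹ • (f (u + t • x) - f u)) (𝓝[≠] 0) (𝓝 (df (u, x)))) ∧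
        ContinuousOn df (U ×ˢ (univ : Set E)) ∧
        KellerCNat 𝕜 n df (U ×ˢ (univ : Set E))

/-- `f` is of class `C^ℓ` on `U`, for `ℓ ∈ ℕ ∪ {∞}`. -/
def KellerC (𝕜 : Type*) [RCLike 𝕜] {F : Type v} [AddCommGroup F] [Module 𝕜 F]
    [TopologicalSpace F] {E : Type u} [AddCommGroup E] [Module 𝕜 E] [TopologicalSpace E]
    (ℓ : ℕ∞) (f : E → F) (U : Set E) : Prop :=
  ∀ n : ℕ, (n : ℕ∞) ≤ ℓ → KellerCNat 𝕜 n f U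

/-! ### Weighted restricted products -/

/-- Absolute value of a weight value in `ℝ ∪ {∞}`, with `|∞| = ∞`. -/
def wabs : WithTop ℝ → ℝ≥0∞
  | ⊤ => ⊤
  | (a : ℝ) => ‖a‖ₑ

section Space

variable (𝕜 : Type*) [RCLike 𝕜] {I : Type*}
  {X : I → Type*} [∀ i, NormedAddCommGroup (X i)] [∀ i, NormedSpace 𝕜 (X i)]
  (U : ∀ i, TopologicalSpace.Opens (X i))
  (Y : I → Type*) [∀ i, NormedAddCommGroup (Y i)] [∀ i, NormedSpace 𝕜 (Y i)]

open Classical in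
/-- Extension by zero of a function given on an open set. It only serves to speak of the Fréchet
derivatives at points of the open set, where they do not depend on the extension. -/
def zeroExt {A B : Type*} [TopologicalSpace A] [Zero B] {O : TopologicalSpace.Opens A}
    (φ : O → B) : A → B :=
  fun x => if h : x ∈ O then φ ⟨x, h⟩ else 0

variable {Y} in
/-- The quasinorm `‖(φ_i)‖_{f,ℓ} = sup_i sup_{x ∈ U_i} |f_i(x)| ‖D^ℓ φ_i (x)‖ ∈ [0,∞]`
(with `∞ · 0 = 0`), for a weight `f` on the disjoint union of the `U_i`. -/
def wnorm {U : ∀ i, TopologicalSpace.Opens (X i)} (f : (Σ i, U i) → WithTop ℝ) (ℓ : ℕ)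
    (φ : ∀ i, U i → Y i) : ℝ≥0∞ :=
  ⨆ (i : I) (x : U i), wabs (f ⟨i, x⟩) * ‖iteratedFDeriv 𝕜 ℓ (zeroExt (φ i)) (x : X i)‖ₑ

lemma zeroExt_add {A B : Type*} [TopologicalSpace A] [AddZeroClass B]
    {O : TopologicalSpace.Opens A} (φ ψ : O → B) :
    zeroExt (φ + ψ) = zeroExt φ + zeroExt ψ := by
  funext x
  by_cases h : x ∈ O <;> simp [zeroExt, h]

lemma zeroExt_smul {A B : Type*} [TopologicalSpace A] [AddCommGroup B] [Module 𝕜 B]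
    {O : TopologicalSpace.Opens A} (c : 𝕜) (φ : O → B) :
    zeroExt (c • φ) = c • zeroExt φ := by
  funext x
  by_cases h : x ∈ O <;> simp [zeroExt, h]

lemma zeroExt_zero {A B : Type*} [TopologicalSpace A] [Zero B]
    {O : TopologicalSpace.Opens A} : zeroExt (0 : O → B) = 0 := by
  funext x
  by_cases h : x ∈ O <;> simp [zeroExt, h]

variable {U Y} in
/-- Each `φ_i` is `k` times continuously Fréchet differentiable on `U_i`. -/
def IsFC (k : ℕ∞) (φ : ∀ i, U i → Y i) : Prop :=
  ∀ i, ContDiffOn 𝕜 k (zeroExt (φ i)) (U i : Set (X i))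

variable {𝕜 U Y} in
lemma IsFC.contDiffAt {k : ℕ∞} {φ : ∀ i, U i → Y i} (h : IsFC 𝕜 k φ) {ℓ : ℕ}
    (hℓ : (ℓ : ℕ∞) ≤ k) (i : I) (x : U i) :
    ContDiffAt 𝕜 ℓ (zeroExt (φ i)) (x : X i) :=
  ((h i).contDiffAt ((U i).isOpen.mem_nhds x.2)).of_le (by exact_mod_cast hℓ)

variable {𝕜 U Y} in
lemma wnorm_add_le {k : ℕ∞} {φ ψ : ∀ i, U i → Y i} (hφ : IsFC 𝕜 k φ) (hψ : IsFC 𝕜 k ψ)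
    (f : (Σ i, U i) → WithTop ℝ) {ℓ : ℕ} (hℓ : (ℓ : ℕ∞) ≤ k) :
    wnorm 𝕜 f ℓ (φ + ψ) ≤ wnorm 𝕜 f ℓ φ + wnorm 𝕜 f ℓ ψ := by
  refine iSup₂_le fun i x => ?_
  rw [Pi.add_apply, zeroExt_add,
    iteratedFDeriv_add_apply (hφ.contDiffAt hℓ i x) (hψ.contDiffAt hℓ i x)]
  calc _ ≤ wabs (f ⟨i, x⟩) * (‖iteratedFDeriv 𝕜 ℓ (zeroExt (φ i)) (x : X i)‖ₑ
        + ‖iteratedFDeriv 𝕜 ℓ (zeroExt (ψ i)) (x : X i)‖ₑ) := by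
        gcongr; exact enorm_add_le (iteratedFDeriv 𝕜 ℓ (zeroExt (φ i)) (x : X i)) _
    _ ≤ _ := by
        rw [mul_add]
        refine add_le_add ?_ ?_
        · exact le_iSup₂_of_le i x le_rfl
        · exact le_iSup₂_of_le i x le_rfl

variable {𝕜 U Y} in
lemma wnorm_smul {k : ℕ∞} {φ : ∀ i, U i → Y i} (hφ : IsFC 𝕜 k φ) (c : 𝕜)
    (f : (Σ i, U i) → WithTop ℝ) {ℓ : ℕ} (hℓ : (ℓ : ℕ∞) ≤ k) :
    wnorm 𝕜 f ℓ (c • φ) = ‖c‖ₑ * wnorm 𝕜 f ℓ φ := by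
  simp only [wnorm, ENNReal.mul_iSup]
  refine iSup_congr fun i => iSup_congr fun x => ?_
  rw [Pi.smul_apply, zeroExt_smul, iteratedFDeriv_const_smul_apply (hφ.contDiffAt hℓ i x),
    enorm_smul, mul_left_comm]

lemma wnorm_zero (f : (Σ i, U i) → WithTop ℝ) (ℓ : ℕ) :
    wnorm 𝕜 f ℓ (0 : ∀ i, U i → Y i) = 0 := by
  simp only [wnorm, ENNReal.iSup_eq_zero]
  intro i x
  rw [Pi.zero_apply, zeroExt_zero]
  have h : iteratedFDeriv 𝕜 ℓ (0 : X i → Y i) = 0 := iteratedFDeriv_fun_zero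
  rw [h, Pi.zero_apply, ← ofReal_norm, norm_zero, ENNReal.ofReal_zero, mul_zero]

/-- The vector space underlying the restricted product of the weighted function spaces
`C^k_{𝒲_i}(U_i, Y_i)`. -/
def weightedSubmodule (𝒲 : Set ((Σ i, U i) → WithTop ℝ)) (k : ℕ∞) :
    Submodule 𝕜 (∀ i, U i → Y i) where
  carrier := {φ | IsFC 𝕜 k φ ∧ ∀ f ∈ 𝒲, ∀ ℓ : ℕ, (ℓ : ℕ∞) ≤ k → wnorm 𝕜 f ℓ φ < ⊤}
  add_mem' := by
    rintro φ ψ ⟨h1, h2⟩ ⟨h3, h4⟩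
    refine ⟨fun i => ?_, fun f hf ℓ hℓ => ?_⟩
    · rw [Pi.add_apply, zeroExt_add]
      exact (h1 i).add (h3 i)
    · exact (wnorm_add_le h1 h3 f hℓ).trans_lt (ENNReal.add_lt_top.2 ⟨h2 f hf ℓ hℓ, h4 f hf ℓ hℓ⟩)
  zero_mem' := by
    refine ⟨fun i => ?_, fun f _ ℓ _ => ?_⟩
    · rw [Pi.zero_apply, zeroExt_zero]
      exact contDiffOn_const
    · rw [wnorm_zero]
      exact ENNReal.zero_lt_top
  smul_mem' := by
    rintro c φ ⟨h1, h2⟩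
    refine ⟨fun i => ?_, fun f hf ℓ hℓ => ?_⟩
    · rw [Pi.smul_apply, zeroExt_smul]
      exact (h1 i).const_smul c
    · rw [wnorm_smul h1 c f hℓ]
      exact ENNReal.mul_lt_top enorm_lt_top (h2 f hf ℓ hℓ)

/-- The weighted restricted product `C^k_𝒲(U_i, Y_i)_{i ∈ I}`. This is a type of its own, so that
it does not inherit the topology of pointwise convergence. -/
def RProd (𝒲 : Set ((Σ i, U i) → WithTop ℝ)) (k : ℕ∞) : Type _ :=
  ↥(weightedSubmodule 𝕜 U Y 𝒲 k)

variable (𝒲 : Set ((Σ i, U i) → WithTop ℝ)) (k : ℕ∞)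

instance : AddCommGroup (RProd 𝕜 U Y 𝒲 k) :=
  inferInstanceAs (AddCommGroup ↥(weightedSubmodule 𝕜 U Y 𝒲 k))

instance : Module 𝕜 (RProd 𝕜 U Y 𝒲 k) :=
  inferInstanceAs (Module 𝕜 ↥(weightedSubmodule 𝕜 U Y 𝒲 k))

instance : CoeFun (RProd 𝕜 U Y 𝒲 k) (fun _ => ∀ i, U i → Y i) where
  coe φ := φ.1

/-- The generating seminorms `‖·‖_{f,ℓ}`, `f ∈ 𝒲`, `ℓ ∈ ℕ`, `ℓ ≤ k`. -/
def wseminorm : SeminormFamily 𝕜 (RProd 𝕜 U Y 𝒲 k) (𝒲 × {ℓ : ℕ // (ℓ : ℕ∞) ≤ k}) :=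
  fun j => Seminorm.of (fun φ => (wnorm 𝕜 j.1.1 j.2.1 φ.1).toReal)
    (fun φ ψ => by
      have h := wnorm_add_le φ.2.1 ψ.2.1 j.1.1 j.2.2
      have h1 := φ.2.2 _ j.1.2 _ j.2.2
      have h2 := ψ.2.2 _ j.1.2 _ j.2.2
      exact (ENNReal.toReal_mono (ENNReal.add_ne_top.2 ⟨h1.ne, h2.ne⟩) h).trans
        ENNReal.toReal_add_le)
    (fun c φ => by
      have h := wnorm_smul φ.2.1 c j.1.1 j.2.2
      exact (congrArg ENNReal.toReal h).trans (by simp [ENNReal.toReal_mul]))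

/-- The locally convex topology defined by the seminorms `‖·‖_{f,ℓ}`. -/
instance : TopologicalSpace (RProd 𝕜 U Y 𝒲 k) :=
  ⨅ j, (wseminorm 𝕜 U Y 𝒲 k j).toSeminormedAddCommGroup.toUniformSpace.toTopologicalSpace

variable {𝕜 U 𝒲 k} in
/-- For families `V_i ⊆ Y_i` and `ω` on the disjoint union of the `U_i`, the set of all `(η_i)` in
the restricted product such that for some `r > 0`, the ball of radius `r / |ω(x)|` around `η_i(x)`
is contained in `V_i` for all `i` and all `x ∈ U_i`. -/
def omegaSet (V : ∀ i, Set (Y i)) (ω : (Σ i, U i) → ℝ) : Set (RProd 𝕜 U Y 𝒲 k) :=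
  {η | ∃ r : ℝ, 0 < r ∧ ∀ (i : I) (x : U i), Metric.ball (η i x) (r / |ω ⟨i, x⟩|) ⊆ V i}

end Space

section Weights

variable {I : Type*} {X : I → Type*} [∀ i, NormedAddCommGroup (X i)]
  {U W : ∀ i, TopologicalSpace.Opens (X i)}

/-- Restriction of a function on the disjoint union of the `W_i` to that of the `U_i ⊆ W_i`. -/
def restrictFun {α : Type*} (h : ∀ i, U i ≤ W i) (f : (Σ i, W i) → α) : (Σ i, U i) → α :=
  fun p => f ⟨p.1, ⟨p.2.1, h p.1 p.2.2⟩⟩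

/-- `ω` is an adjusting weight for the family `r_i ∈ ]0,∞]`. -/
def IsAdjustingWeight (ω : (Σ i, W i) → ℝ) (r : I → ℝ≥0∞) : Prop :=
  ∀ i, (⨆ x : W i, ‖ω ⟨i, x⟩‖ₑ) < ⊤ ∧ max (r i)⁻¹ 1 ≤ ⨅ x : W i, ‖ω ⟨i, x⟩‖ₑ

/-- `ω` is an adjusting weight for the family `V_i` of open sets that are star-shaped with
centre `0`: it is one for the family of the distances of `0` to the boundary of `V_i`
(`∞` if this boundary is empty). -/
def IsAdjustingWeightFor {Y : I → Type*} [∀ i, NormedAddCommGroup (Y i)]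
    (ω : (Σ i, W i) → ℝ) (V : ∀ i, Set (Y i)) : Prop :=
  IsAdjustingWeight ω (fun i => Metric.infEDist (0 : Y i) (frontier (V i)))

lemma le_of_add_subset {𝕜 : Type*} [RCLike 𝕜] [∀ i, NormedSpace 𝕜 (X i)]
    {V : ∀ i, TopologicalSpace.Opens (X i)}
    (hV : ∀ i, (V i : Set (X i)).Nonempty) (hbal : ∀ i, Balanced 𝕜 (V i : Set (X i)))
    (hUVW : ∀ i, ∀ x ∈ U i, ∀ v ∈ V i, x + v ∈ W i) (i : I) : U i ≤ W i := fun x hx => by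
  simpa using hUVW i x hx 0 ((hbal i).zero_mem (hV i))

end Weights

end WeightedProd

end

noncomputable section

namespace WeightedProd

/-! ### Rules of Keller's calculus -/

section Keller

universe u u' v

variable {𝕜 : Type*} [RCLike 𝕜] {F : Type v} [AddCommGroup F] [Module 𝕜 F] [TopologicalSpace F]
  {E : Type u} [AddCommGroup E] [Module 𝕜 E] [TopologicalSpace E]
  {E' : Type u'} [AddCommGroup E'] [Module 𝕜 E'] [TopologicalSpace E']

/-! Write comp(γ, η) = γ ∘ (η + id). Both derivatives of this expression, the one in (γ, η) and the
one in the point x, are again made of such compositions, so one estimate and two inductions suffice.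

Estimate. As |ω| ≥ 1, the seminorms ‖·‖_{ω,j} bound sup ‖D^j‖. As V_i is balanced, U_i + V_i ⊆ W_i
and the balls in the definition of Ω lie in V_i, the segments from x to x + η(x), and from x + η(x)
to x + η'(x) for η' near η, stay in W_i. The mean value inequality (`enorm_sub_le_of_segment`) along
them gives |f(x)| ‖D^jγ(x + η(x))‖ ≤ ‖γ‖_{f,j} + ‖γ‖_{ω,j+1} ‖η‖_{f,0}, at the cost of one
derivative of γ. With the Faà di Bruno bound, comp takes values in C^k.

Order n, for k = 0. Such estimates yield continuity and the derivative γ₁ ∘ (η + id) + (Dγ ∘ (η +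
id)) · η₁ in direction (γ₁, η₁). It is assembled from comp, continuous linear maps and a continuous
bilinear map, so induction on n applies (`kellerCNat_comp_zero`); each step uses up one derivative
of γ.

Order k. The map φ ↦ (φ, Dφ) embeds C^(k+1) into C^0 × C^k with closed image
(`le_nhds_of_tendsto_deriv`, `exists_of_tendsto_deriv`), so differentiability is tested on the two
components (`KellerCNat.of_inducing`). The second component is (Dγ ∘ (η + id)) · Dη + Dγ ∘ (η + id)
(`deriv_comp`), which involves comp only for k. The space C^∞ is the projective limit of the C^k
with k finite. -/

lemma KellerCNat.continuousOn {n : ℕ} {f : E → F} {Q : Set E} (h : KellerCNat 𝕜 n f Q) :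
    ContinuousOn f Q := by
  cases n with
  | zero => exact h
  | succ n => exact h.1

lemma KellerCNat.of_succ {n : ℕ} {E : Type u} [AddCommGroup E] [Module 𝕜 E] [TopologicalSpace E]
    {f : E → F} {Q : Set E} (h : KellerCNat 𝕜 (n + 1) f Q) : KellerCNat 𝕜 n f Q := by
  induction n generalizing E with
  | zero => exact h.continuousOn
  | succ n ih =>
    obtain ⟨hc, df, hd, hdc, hn⟩ := h
    exact ⟨hc, df, hd, hdc, ih hn⟩

lemma eventually_add_smul_mem [ContinuousAdd E] [ContinuousSMul 𝕜 E] {Q : Set E}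
    (hQ : IsOpen Q) {u : E} (hu : u ∈ Q) (x : E) : ∀ᶠ t : 𝕜 in 𝓝[≠] 0, u + t • x ∈ Q := by
  have h : Tendsto (fun t : 𝕜 => u + t • x) (𝓝 0) (𝓝 u) := by
    have h' : Continuous (fun t : 𝕜 => u + t • x) := by fun_prop
    simpa using h'.tendsto 0
  exact (h.eventually (hQ.mem_nhds hu)).filter_mono nhdsWithin_le_nhds

lemma tendsto_add_smul [ContinuousAdd E] [ContinuousSMul 𝕜 E] {Q : Set E}
    (hQ : IsOpen Q) {u : E} (hu : u ∈ Q) (x : E) :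
    Tendsto (fun t : 𝕜 => u + t • x) (𝓝[≠] 0) (𝓝[Q] u) := by
  refine tendsto_nhdsWithin_iff.2 ⟨?_, eventually_add_smul_mem hQ hu x⟩
  have h' : Continuous (fun t : 𝕜 => u + t • x) := by fun_prop
  simpa using (h'.tendsto 0).mono_left nhdsWithin_le_nhds

lemma KellerCNat.congr [ContinuousAdd E] [ContinuousSMul 𝕜 E] {n : ℕ} {f g : E → F} {Q : Set E}
    (h : KellerCNat 𝕜 n f Q) (hQ : IsOpen Q) (hfg : EqOn g f Q) : KellerCNat 𝕜 n g Q := by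
  cases n with
  | zero => exact ContinuousOn.congr h hfg
  | succ n =>
    obtain ⟨hc, df, hd, hn⟩ := h
    refine ⟨hc.congr hfg, df, fun u hu x => (hd u hu x).congr' ?_, hn⟩
    filter_upwards [eventually_add_smul_mem hQ hu x] with t ht
    rw [hfg ht, hfg hu]

/-- Stands in for a general chain rule: all substitutions needed below are linear. The derivative of
f ∘ L is df ∘ (L × L), of the same shape on larger spaces, so the spaces vary in the induction. -/
lemma KellerCNat.comp_clm {n : ℕ} {E : Type u} [AddCommGroup E] [Module 𝕜 E] [TopologicalSpace E]
    {E' : Type u'} [AddCommGroup E'] [Module 𝕜 E'] [TopologicalSpace E']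
    {f : E → F} {Q : Set E} (h : KellerCNat 𝕜 n f Q) (L : E' →L[𝕜] E) {Q' : Set E'}
    (hL : MapsTo L Q' Q) : KellerCNat 𝕜 n (fun x => f (L x)) Q' := by
  induction n generalizing E E' with
  | zero => exact ContinuousOn.comp h L.continuous.continuousOn hL
  | succ n ih =>
    obtain ⟨hc, df, hd, hdc, hn⟩ := h
    have hLL : MapsTo (L.prodMap L) (Q' ×ˢ univ) (Q ×ˢ univ) := fun p hp => ⟨hL hp.1, trivial⟩
    refine ⟨hc.comp L.continuous.continuousOn hL, fun p => df (L.prodMap L p), fun u hu x => ?_,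
      hdc.comp (L.prodMap L).continuous.continuousOn hLL, ih hn (L.prodMap L) hLL⟩
    simpa using hd (L u) (hL hu) (L x)

lemma ContinuousLinearMap.kellerCNat (n : ℕ) {E : Type u} [AddCommGroup E] [Module 𝕜 E]
    [TopologicalSpace E] (L : E →L[𝕜] F) (Q : Set E) : KellerCNat 𝕜 n L Q := by
  induction n generalizing E with
  | zero => exact L.continuous.continuousOn
  | succ n ih =>
    refine ⟨L.continuous.continuousOn, fun p => L p.2, fun u _ x => ?_,
      (L.continuous.comp continuous_snd).continuousOn,
      ih (L.comp (ContinuousLinearMap.snd 𝕜 E E)) _⟩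
    refine tendsto_const_nhds.congr' ?_
    filter_upwards [self_mem_nhdsWithin] with t ht
    simp [smul_smul, inv_mul_cancel₀ (show t ≠ 0 from ht)]

lemma KellerCNat.add [ContinuousAdd F] {n : ℕ} {E : Type u} [AddCommGroup E]
    [Module 𝕜 E] [TopologicalSpace E] {f g : E → F} {Q : Set E} (hf : KellerCNat 𝕜 n f Q)
    (hg : KellerCNat 𝕜 n g Q) : KellerCNat 𝕜 n (fun x => f x + g x) Q := by
  induction n generalizing E with
  | zero => exact ContinuousOn.add hf hg
  | succ n ih =>
    obtain ⟨hc, df, hd, hdc, hn⟩ := hf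
    obtain ⟨hc', dg, hd', hdc', hn'⟩ := hg
    refine ⟨hc.add hc', fun p => df p + dg p, fun u hu x => ?_, hdc.add hdc', ih hn hn'⟩
    refine ((hd u hu x).add (hd' u hu x)).congr fun t => ?_
    rw [← smul_add, sub_add_sub_comm]

lemma KellerCNat.prodMk {F' : Type*} [AddCommGroup F'] [Module 𝕜 F'] [TopologicalSpace F']
    {n : ℕ} {E : Type u} [AddCommGroup E] [Module 𝕜 E] [TopologicalSpace E] {f : E → F}
    {g : E → F'} {Q : Set E} (hf : KellerCNat 𝕜 n f Q) (hg : KellerCNat 𝕜 n g Q) :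
    KellerCNat 𝕜 n (fun x => (f x, g x)) Q := by
  induction n generalizing E with
  | zero => exact ContinuousOn.prodMk hf hg
  | succ n ih =>
    obtain ⟨hc, df, hd, hdc, hn⟩ := hf
    obtain ⟨hc', dg, hd', hdc', hn'⟩ := hg
    exact ⟨hc.prodMk hc', fun p => (df p, dg p), fun u hu x =>
      (hd u hu x).prodMk_nhds (hd' u hu x), hdc.prodMk hdc', ih hn hn'⟩

/-- The product rule, for a continuous bilinear map. -/
lemma KellerCNat.bilinear [ContinuousAdd F] {v₁ v₂ : Type*} [AddCommGroup v₁] [Module 𝕜 v₁]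
    [TopologicalSpace v₁] [AddCommGroup v₂] [Module 𝕜 v₂] [TopologicalSpace v₂]
    (b : v₁ →ₗ[𝕜] v₂ →ₗ[𝕜] F) (hb : Continuous fun p : v₁ × v₂ => b p.1 p.2) {n : ℕ}
    {E : Type u} [AddCommGroup E] [Module 𝕜 E] [TopologicalSpace E] [IsTopologicalAddGroup E]
    [ContinuousSMul 𝕜 E] {f : E → v₁} {g : E → v₂} {Q : Set E} (hQ : IsOpen Q)
    (hf : KellerCNat 𝕜 n f Q) (hg : KellerCNat 𝕜 n g Q) :
    KellerCNat 𝕜 n (fun x => b (f x) (g x)) Q := by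
  induction n generalizing E with
  | zero => exact hb.comp_continuousOn (ContinuousOn.prodMk hf hg)
  | succ n ih =>
    have hf' := hf.of_succ
    have hg' := hg.of_succ
    obtain ⟨hc, df, hd, hdc, hn⟩ := hf
    obtain ⟨hc', dg, hd', hdc', hn'⟩ := hg
    have hQ' : IsOpen (Q ×ˢ (univ : Set E)) := hQ.prod isOpen_univ
    have hfst : MapsTo (ContinuousLinearMap.fst 𝕜 E E) (Q ×ˢ univ) Q := fun p hp => hp.1
    -- The derivative b(df, g) + b(f, dg) is again built from b, now on Q × E, so the induction
    -- hypothesis covers it.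
    have key : KellerCNat 𝕜 n (fun p : E × E => b (df p) (g p.1) + b (f p.1) (dg p))
        (Q ×ˢ univ) :=
      (ih hQ' hn (hg'.comp_clm _ hfst)).add (ih hQ' (hf'.comp_clm _ hfst) hn')
    refine ⟨hb.comp_continuousOn (hc.prodMk hc'), _, fun u hu x => ?_, key.continuousOn, key⟩
    -- The quotient is b(Δf/t, g(u + tx)) + b(f u, Δg/t).
    have h1 : Tendsto (fun t : 𝕜 => b (t⁻¹ • (f (u + t • x) - f u)) (g (u + t • x))) (𝓝[≠] 0)
        (𝓝 (b (df (u, x)) (g u))) :=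
      (hb.tendsto (df (u, x), g u)).comp
        ((hd u hu x).prodMk_nhds ((hc' u hu).tendsto.comp (tendsto_add_smul hQ hu x)))
    have h2 : Tendsto (fun t : 𝕜 => b (f u) (t⁻¹ • (g (u + t • x) - g u))) (𝓝[≠] 0)
        (𝓝 (b (f u) (dg (u, x)))) :=
      (hb.tendsto (f u, dg (u, x))).comp (tendsto_const_nhds.prodMk_nhds (hd' u hu x))
    refine (h1.add h2).congr fun t => ?_
    simp only [map_smul, map_sub, LinearMap.smul_apply, LinearMap.sub_apply, ← smul_add]
    congr 1
    abel

/-- A map into `F` is of class `C^n` if it is so after composition with the linear maps `j a`,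
provided that these induce the topology of `F` and satisfy a closedness condition. -/
lemma KellerCNat.of_inducing {ι : Type*} {G : ι → Type*} [∀ a, AddCommGroup (G a)]
    [∀ a, Module 𝕜 (G a)] [∀ a, TopologicalSpace (G a)] (j : ∀ a, F →ₗ[𝕜] G a)
    (hj : ∀ (l : Filter F) (y : F), (∀ a, Tendsto (j a) l (𝓝 (j a y))) → l ≤ 𝓝 y)
    (hcl : ∀ (q : 𝕜 → F) (y : ∀ a, G a),
      (∀ a, Tendsto (fun t => j a (q t)) (𝓝[≠] 0) (𝓝 (y a))) → ∃ z, ∀ a, j a z = y a)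
    {n : ℕ} {E : Type u} [AddCommGroup E] [Module 𝕜 E] [TopologicalSpace E]
    [ContinuousAdd E] [ContinuousSMul 𝕜 E] {f : E → F} {Q : Set E} (hQ : IsOpen Q)
    (hf : ∀ a, KellerCNat 𝕜 n (fun x => j a (f x)) Q) : KellerCNat 𝕜 n f Q := by
  classical
  induction n generalizing E with
  | zero => exact fun x hx => hj _ _ fun a => tendsto_map'_iff.2 <| hf a x hx
  | succ n ih =>
    choose hc df hd hdc hn using hf
    -- The quotients converge in each `G a`; the closedness condition turns the family of limits
    -- into one element of F. Off Q any value will do.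
    have hex : ∀ p : E × E, ∃ z, p ∈ Q ×ˢ (univ : Set E) → ∀ a, j a z = df a p := by
      intro p
      by_cases hp : p ∈ Q ×ˢ (univ : Set E)
      · obtain ⟨z, hz⟩ := hcl (fun t => t⁻¹ • (f (p.1 + t • p.2) - f p.1)) (fun a => df a p)
          (fun a => by simpa using hd a p.1 hp.1 p.2)
        exact ⟨z, fun _ => hz⟩
      · exact ⟨0, fun h => absurd h hp⟩
    choose dF hdF using hex
    have key : KellerCNat 𝕜 n dF (Q ×ˢ univ) :=
      ih (hQ.prod isOpen_univ) fun a =>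
        (hn a).congr (hQ.prod isOpen_univ) fun p hp => hdF p hp a
    refine ⟨fun x hx => hj _ _ fun a => tendsto_map'_iff.2 <| hc a x hx, dF, fun u hu x => ?_,
      key.continuousOn, key⟩
    refine hj _ _ fun a => tendsto_map'_iff.2 ?_
    rw [hdF (u, x) ⟨hu, trivial⟩ a]
    simpa [Function.comp_def] using hd a u hu x

end Keller

/-! ### Maps between weighted restricted products -/

section ZeroExt

variable {A B : Type*} [TopologicalSpace A] [Zero B] {O : TopologicalSpace.Opens A}

lemma zeroExt_of_mem (φ : O → B) {x : A} (hx : x ∈ O) : zeroExt φ x = φ ⟨x, hx⟩ := by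
  simp [zeroExt, hx]

@[simp] lemma zeroExt_coe (φ : O → B) (x : O) : zeroExt φ (x : A) = φ x := zeroExt_of_mem φ x.2

lemma zeroExt_eqOn {φ : O → B} {G : A → B} (h : ∀ x : O, φ x = G x) :
    EqOn (zeroExt φ) G (O : Set A) := fun x hx => by
  rw [zeroExt_of_mem φ hx, h]

lemma zeroExt_eventuallyEq {φ : O → B} {G : A → B} (h : ∀ x : O, φ x = G x) (x : O) :
    zeroExt φ =ᶠ[𝓝 (x : A)] G :=
  (zeroExt_eqOn h).eventuallyEq_of_mem (O.isOpen.mem_nhds x.2)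

lemma zeroExt_map₂ {C D : Type*} [Zero C] [Zero D] (b : B → C → D) (hb : b 0 0 = 0) (φ : O → B)
    (ψ : O → C) :
    zeroExt (fun x => b (φ x) (ψ x)) = fun y => b (zeroExt φ y) (zeroExt ψ y) := by
  funext y
  by_cases hy : y ∈ O <;> simp [zeroExt, hy, hb]

end ZeroExt

/-! ### Seminorms, and continuous linear and bilinear maps of restricted products -/

section Topology

variable {𝕜 : Type*} [RCLike 𝕜] {I : Type*}
  {X : I → Type*} [∀ i, NormedAddCommGroup (X i)] [∀ i, NormedSpace 𝕜 (X i)]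
  {U : ∀ i, TopologicalSpace.Opens (X i)}
  {Y : I → Type*} [∀ i, NormedAddCommGroup (Y i)] [∀ i, NormedSpace 𝕜 (Y i)]
  {Z : I → Type*} [∀ i, NormedAddCommGroup (Z i)] [∀ i, NormedSpace 𝕜 (Z i)]
  {𝒲 : Set ((Σ i, U i) → WithTop ℝ)} {k m : ℕ∞}

lemma le_wnorm (f : (Σ i, U i) → WithTop ℝ) (l : ℕ) (φ : ∀ i, U i → Y i) (i : I) (x : U i) :
    wabs (f ⟨i, x⟩) * ‖iteratedFDeriv 𝕜 l (zeroExt (φ i)) (x : X i)‖ₑ ≤ wnorm 𝕜 f l φ :=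
  le_iSup₂_of_le i x le_rfl

lemma le_wnorm_of_one_le {f : (Σ i, U i) → WithTop ℝ} (hf : ∀ p, 1 ≤ wabs (f p)) (l : ℕ)
    (φ : ∀ i, U i → Y i) (i : I) (x : U i) :
    ‖iteratedFDeriv 𝕜 l (zeroExt (φ i)) (x : X i)‖ₑ ≤ wnorm 𝕜 f l φ :=
  (le_mul_of_one_le_left' (hf ⟨i, x⟩)).trans (le_wnorm f l φ i x)

lemma enorm_iteratedFDeriv_zero {A B : Type*} [NormedAddCommGroup A] [NormedSpace 𝕜 A]
    [NormedAddCommGroup B] [NormedSpace 𝕜 B] (G : A → B) (x : A) :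
    ‖iteratedFDeriv 𝕜 0 G x‖ₑ = ‖G x‖ₑ := by
  rw [← ofReal_norm, ← ofReal_norm, norm_iteratedFDeriv_zero]

lemma wnorm_zero_eq (f : (Σ i, U i) → WithTop ℝ) (φ : ∀ i, U i → Y i) :
    wnorm 𝕜 f 0 φ = ⨆ (i : I) (x : U i), wabs (f ⟨i, x⟩) * ‖φ i x‖ₑ := by
  simp only [wnorm, enorm_iteratedFDeriv_zero, zeroExt_coe]

lemma mul_enorm_le_wnorm (f : (Σ i, U i) → WithTop ℝ) (φ : ∀ i, U i → Y i) (i : I) (x : U i) :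
    wabs (f ⟨i, x⟩) * ‖φ i x‖ₑ ≤ wnorm 𝕜 f 0 φ := by
  rw [wnorm_zero_eq]
  exact le_iSup₂_of_le i x le_rfl

lemma enorm_le_wnorm_of_one_le {f : (Σ i, U i) → WithTop ℝ} (hf : ∀ p, 1 ≤ wabs (f p))
    (φ : ∀ i, U i → Y i) (i : I) (x : U i) : ‖φ i x‖ₑ ≤ wnorm 𝕜 f 0 φ :=
  (le_mul_of_one_le_left' (hf ⟨i, x⟩)).trans (mul_enorm_le_wnorm f φ i x)

namespace RProd

@[ext] lemma ext {φ ψ : RProd 𝕜 U Y 𝒲 k} (h : ∀ i x, φ i x = ψ i x) : φ = ψ :=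
  Subtype.ext (funext fun i => funext fun x => h i x)

lemma isFC (φ : RProd 𝕜 U Y 𝒲 k) : IsFC 𝕜 k φ.1 := φ.2.1

lemma wnorm_lt_top (φ : RProd 𝕜 U Y 𝒲 k) {f : (Σ i, U i) → WithTop ℝ} (hf : f ∈ 𝒲) {l : ℕ}
    (hl : (l : ℕ∞) ≤ k) : wnorm 𝕜 f l φ.1 < ⊤ := φ.2.2 f hf l hl

@[simp] lemma add_apply (φ ψ : RProd 𝕜 U Y 𝒲 k) (i : I) (x : U i) :
    (φ + ψ) i x = φ i x + ψ i x := rfl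

@[simp] lemma sub_apply (φ ψ : RProd 𝕜 U Y 𝒲 k) (i : I) (x : U i) :
    (φ - ψ) i x = φ i x - ψ i x := rfl

@[simp] lemma smul_apply (c : 𝕜) (φ : RProd 𝕜 U Y 𝒲 k) (i : I) (x : U i) :
    (c • φ) i x = c • φ i x := rfl

@[simp] lemma zero_apply (i : I) (x : U i) : (0 : RProd 𝕜 U Y 𝒲 k) i x = 0 := rfl

instance : IsTopologicalAddGroup (RProd 𝕜 U Y 𝒲 k) :=
  topologicalAddGroup_iInf fun j =>
    letI := (wseminorm 𝕜 U Y 𝒲 k j).toSeminormedAddCommGroup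
    inferInstance

variable (𝕜 U Y 𝒲 k) in
lemma withSeminorms_wseminorm : WithSeminorms (wseminorm 𝕜 U Y 𝒲 k) :=
  (SeminormFamily.withSeminorms_iff_topologicalSpace_eq_iInf _).2 rfl

instance : ContinuousSMul 𝕜 (RProd 𝕜 U Y 𝒲 k) :=
  (withSeminorms_wseminorm 𝕜 U Y 𝒲 k).continuousSMul

/-- The quasinorms are finite on the space, so `toReal` can be dropped. Later estimates then take
place in [0, ∞], pointwise and without finiteness conditions. -/
lemma tendsto_iff {α : Type*} {l : Filter α} {u : α → RProd 𝕜 U Y 𝒲 k} {φ : RProd 𝕜 U Y 𝒲 k} :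
    Tendsto u l (𝓝 φ) ↔ ∀ f ∈ 𝒲, ∀ j : ℕ, (j : ℕ∞) ≤ k →
      Tendsto (fun a => wnorm 𝕜 f j (u a - φ).1) l (𝓝 0) := by
  rw [(withSeminorms_wseminorm 𝕜 U Y 𝒲 k).tendsto_nhds]
  have key : ∀ i : 𝒲 × {ℓ : ℕ // (ℓ : ℕ∞) ≤ k},
      (∀ ε : ℝ, 0 < ε → ∀ᶠ a in l, wseminorm 𝕜 U Y 𝒲 k i (u a - φ) < ε) ↔
        Tendsto (fun a => wnorm 𝕜 i.1.1 i.2.1 (u a - φ).1) l (𝓝 0) := by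
    intro i
    have hfin : ∀ a, wnorm 𝕜 i.1.1 i.2.1 (u a - φ).1 ≠ ⊤ := fun a =>
      ((u a - φ).wnorm_lt_top i.1.2 i.2.2).ne
    rw [← ENNReal.tendsto_toReal_iff hfin ENNReal.zero_ne_top, ENNReal.toReal_zero,
      Metric.tendsto_nhds]
    refine forall₂_congr fun ε hε => eventually_congr (Eventually.of_forall fun a => ?_)
    rw [dist_zero_right, Real.norm_of_nonneg ENNReal.toReal_nonneg]
    rfl
  exact ⟨fun h f hf j hj => (key ⟨⟨f, hf⟩, ⟨j, hj⟩⟩).1 (h _), fun h i =>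
    (key i).2 (h _ i.1.2 _ i.2.2)⟩

lemma continuous_of_wnorm_le {U' : ∀ i, TopologicalSpace.Opens (X i)}
    {𝒲' : Set ((Σ i, U' i) → WithTop ℝ)} (T : RProd 𝕜 U Y 𝒲 m →ₗ[𝕜] RProd 𝕜 U' Z 𝒲' k)
    (h : ∀ f ∈ 𝒲', ∀ j : ℕ, (j : ℕ∞) ≤ k → ∃ f' ∈ 𝒲, ∃ j' : ℕ, (j' : ℕ∞) ≤ m ∧
      ∀ φ, wnorm 𝕜 f j (T φ).1 ≤ wnorm 𝕜 f' j' φ.1) : Continuous T := by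
  refine continuous_iff_continuousAt.2 fun φ => tendsto_iff.2 fun f hf j hj => ?_
  obtain ⟨f', hf', j', hj', hle⟩ := h f hf j hj
  refine tendsto_of_tendsto_of_tendsto_of_le_of_le tendsto_const_nhds
    (tendsto_iff.1 tendsto_id f' hf' j' hj' : Tendsto _ (𝓝 φ) _) (fun _ => zero_le)
    fun ψ => ?_
  simp only [← map_sub]
  exact hle _

/-- The inclusion map `C^m → C^k` for `k ≤ m`. -/
def incl (hk : k ≤ m) : RProd 𝕜 U Y 𝒲 m →L[𝕜] RProd 𝕜 U Y 𝒲 k where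
  toFun φ := ⟨φ.1, fun i => (φ.isFC i).of_le (by exact_mod_cast hk), fun _ hf _ hl =>
    φ.wnorm_lt_top hf (hl.trans hk)⟩
  map_add' _ _ := rfl
  map_smul' _ _ := rfl
  cont := continuous_of_wnorm_le
    (T := { toFun := fun φ => ⟨φ.1, fun i => (φ.isFC i).of_le (by exact_mod_cast hk),
              fun _ hf _ hl => φ.wnorm_lt_top hf (hl.trans hk)⟩
            map_add' := fun _ _ => rfl
            map_smul' := fun _ _ => rfl })
    fun f hf j hj => ⟨f, hf, j, hj.trans hk, fun _ => le_rfl⟩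

@[simp] lemma incl_apply (hk : k ≤ m) (φ : RProd 𝕜 U Y 𝒲 m) (i : I) (x : U i) :
    incl hk φ i x = φ i x := rfl

end RProd

/-- The family of Fréchet derivatives. -/
def derivFam (𝕜 : Type*) [RCLike 𝕜] {X : I → Type*} [∀ i, NormedAddCommGroup (X i)]
    [∀ i, NormedSpace 𝕜 (X i)] {U : ∀ i, TopologicalSpace.Opens (X i)}
    {Y : I → Type*} [∀ i, NormedAddCommGroup (Y i)] [∀ i, NormedSpace 𝕜 (Y i)]
    (φ : ∀ i, U i → Y i) : ∀ i, U i → (X i →L[𝕜] Y i) :=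
  fun i x => fderiv 𝕜 (zeroExt (φ i)) x

/-- D^l(Dφ) and D^(l+1)φ have the same operator norm, so differentiation only shifts the index of
the seminorms. -/
lemma wnorm_derivFam (f : (Σ i, U i) → WithTop ℝ) (l : ℕ) (φ : ∀ i, U i → Y i) :
    wnorm 𝕜 f l (derivFam 𝕜 φ) = wnorm 𝕜 f (l + 1) φ := by
  refine iSup_congr fun i => iSup_congr fun x => ?_
  have h : zeroExt (derivFam 𝕜 φ i) =ᶠ[𝓝 (x : X i)] fderiv 𝕜 (zeroExt (φ i)) :=
    zeroExt_eventuallyEq (fun _ => rfl) x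
  rw [(h.iteratedFDeriv 𝕜 l).self_of_nhds,
    ← ofReal_norm, ← ofReal_norm (iteratedFDeriv 𝕜 (l + 1) _ _), norm_iteratedFDeriv_fderiv]

lemma IsFC.derivFam {φ : ∀ i, U i → Y i} (h : IsFC 𝕜 m φ) (hk : k + 1 ≤ m) :
    IsFC 𝕜 k (derivFam 𝕜 φ) := fun i =>
  ((h i).fderiv_of_isOpen (U i).isOpen (by exact_mod_cast hk)).congr
    (zeroExt_eqOn fun _ => rfl)

lemma IsFC.differentiableAt {φ : ∀ i, U i → Y i} (h : IsFC 𝕜 m φ) (hm : 1 ≤ m) (i : I)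
    (x : U i) : DifferentiableAt 𝕜 (zeroExt (φ i)) (x : X i) :=
  (h.contDiffAt (ℓ := 1) (by exact_mod_cast hm) i x).differentiableAt (by simp)

namespace RProd

/-- The derivative, as a linear map `C^m(U_i, Y_i) → C^k(U_i, L(X_i, Y_i))` for `k + 1 ≤ m`. -/
def derivₗ (hk : k + 1 ≤ m) :
    RProd 𝕜 U Y 𝒲 m →ₗ[𝕜] RProd 𝕜 U (fun i => X i →L[𝕜] Y i) 𝒲 k where
  toFun φ := ⟨derivFam 𝕜 φ.1, φ.isFC.derivFam hk, fun f hf l hl => by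
    rw [wnorm_derivFam]
    exact φ.wnorm_lt_top hf (le_trans (by push_cast; gcongr) hk)⟩
  map_add' φ ψ := by
    have hm : 1 ≤ m := le_trans (by simp) hk
    ext1 i x
    change fderiv 𝕜 (zeroExt (φ i + ψ i)) x = fderiv 𝕜 (zeroExt (φ i)) x + _
    rw [zeroExt_add, fderiv_add (φ.isFC.differentiableAt hm i x)
      (ψ.isFC.differentiableAt hm i x)]
    rfl
  map_smul' c φ := by
    have hm : 1 ≤ m := le_trans (by simp) hk
    ext1 i x
    change fderiv 𝕜 (zeroExt (c • φ i)) x = c • fderiv 𝕜 (zeroExt (φ i)) x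
    rw [zeroExt_smul, fderiv_const_smul (φ.isFC.differentiableAt hm i x)]

/-- The derivative, as a continuous linear map `C^m(U_i, Y_i) → C^k(U_i, L(X_i, Y_i))`
for `k + 1 ≤ m`. -/
def deriv (hk : k + 1 ≤ m) :
    RProd 𝕜 U Y 𝒲 m →L[𝕜] RProd 𝕜 U (fun i => X i →L[𝕜] Y i) 𝒲 k where
  toLinearMap := derivₗ hk
  cont := continuous_of_wnorm_le _ fun f hf j hj =>
    ⟨f, hf, j + 1, le_trans (by push_cast; gcongr) hk, fun φ => (wnorm_derivFam f j φ.1).le⟩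

lemma deriv_apply (hk : k + 1 ≤ m) (φ : RProd 𝕜 U Y 𝒲 m) (i : I) (x : U i) :
    deriv hk φ i x = fderiv 𝕜 (zeroExt (φ i)) x := rfl

end RProd

variable {A B : I → Type*} [∀ i, NormedAddCommGroup (A i)] [∀ i, NormedSpace 𝕜 (A i)]
  [∀ i, NormedAddCommGroup (B i)] [∀ i, NormedSpace 𝕜 (B i)]

/-- Pointwise application of bilinear maps. -/
def mulFam (b : ∀ i, A i →L[𝕜] B i →L[𝕜] Z i) (φ : ∀ i, U i → A i) (ψ : ∀ i, U i → B i) :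
    ∀ i, U i → Z i := fun i x => b i (φ i x) (ψ i x)

lemma IsFC.mulFam {φ : ∀ i, U i → A i} {ψ : ∀ i, U i → B i} (hφ : IsFC 𝕜 k φ) (hψ : IsFC 𝕜 k ψ)
    (b : ∀ i, A i →L[𝕜] B i →L[𝕜] Z i) : IsFC 𝕜 k (mulFam b φ ψ) := fun i => by
  have h : zeroExt (WeightedProd.mulFam b φ ψ i) = _ :=
    zeroExt_map₂ (fun y z => b i y z) (by simp) (φ i) (ψ i)
  rw [h]
  exact (b i).isBoundedBilinearMap.contDiff.comp₂_contDiffOn (hφ i) (hψ i)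

/-- Leibniz rule. Only ψ carries the weight f; for φ a bound suffices, which a weight f₀ with |f₀| ≥
1 provides. Hence no relation between different weights is needed. -/
lemma wnorm_mulFam_le {φ : ∀ i, U i → A i} {ψ : ∀ i, U i → B i} (hφ : IsFC 𝕜 k φ)
    (hψ : IsFC 𝕜 k ψ) {b : ∀ i, A i →L[𝕜] B i →L[𝕜] Z i} (hb : ∀ i, ‖b i‖ ≤ 1)
    {f₀ : (Σ i, U i) → WithTop ℝ} (h₀ : ∀ p, 1 ≤ wabs (f₀ p)) (f : (Σ i, U i) → WithTop ℝ)
    {l : ℕ} (hl : (l : ℕ∞) ≤ k) :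
    wnorm 𝕜 f l (mulFam b φ ψ) ≤
      ∑ j ∈ Finset.range (l + 1), (l.choose j : ℝ≥0∞) *
        (wnorm 𝕜 f₀ j φ * wnorm 𝕜 f (l - j) ψ) := by
  refine iSup₂_le fun i x => ?_
  have h := (b i).norm_iteratedFDerivWithin_le_of_bilinear_of_le_one (hφ i) (hψ i)
    (U i).isOpen.uniqueDiffOn x.2 (n := l) (by exact_mod_cast hl) (hb i)
  simp only [iteratedFDerivWithin_of_isOpen _ (U i).isOpen x.2] at h
  have h' : ‖iteratedFDeriv 𝕜 l (zeroExt (mulFam b φ ψ i)) (x : X i)‖ₑ ≤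
      ∑ j ∈ Finset.range (l + 1), (l.choose j : ℝ≥0∞) *
        (‖iteratedFDeriv 𝕜 j (zeroExt (φ i)) (x : X i)‖ₑ *
          ‖iteratedFDeriv 𝕜 (l - j) (zeroExt (ψ i)) (x : X i)‖ₑ) := by
    have hz : zeroExt (mulFam b φ ψ i) = _ :=
      zeroExt_map₂ (fun y z => b i y z) (by simp) (φ i) (ψ i)
    rw [hz, ← ofReal_norm]
    refine (ENNReal.ofReal_le_ofReal h).trans ?_
    rw [ENNReal.ofReal_sum_of_nonneg fun _ _ => by positivity]
    refine Finset.sum_le_sum fun j _ => ?_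
    rw [ENNReal.ofReal_mul (by positivity), ENNReal.ofReal_mul (by positivity),
      ENNReal.ofReal_natCast, ofReal_norm, ofReal_norm, mul_assoc]
  refine (mul_le_mul_right h' _).trans ?_
  rw [Finset.mul_sum]
  refine Finset.sum_le_sum fun j _ => ?_
  rw [mul_left_comm, mul_left_comm (wabs _)]
  gcongr
  · exact le_wnorm_of_one_le h₀ j φ i x
  · exact le_wnorm f (l - j) ψ i x

namespace RProd

variable {f₀ : (Σ i, U i) → WithTop ℝ}

/-- Pointwise application of bilinear maps, as a bilinear map between restricted products. -/
def mul (b : ∀ i, A i →L[𝕜] B i →L[𝕜] Z i) (hb : ∀ i, ‖b i‖ ≤ 1) (hf₀ : f₀ ∈ 𝒲)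
    (h₀ : ∀ p, 1 ≤ wabs (f₀ p)) :
    RProd 𝕜 U A 𝒲 k →ₗ[𝕜] RProd 𝕜 U B 𝒲 k →ₗ[𝕜] RProd 𝕜 U Z 𝒲 k :=
  LinearMap.mk₂ 𝕜
    (fun φ ψ => ⟨mulFam b φ.1 ψ.1, φ.isFC.mulFam ψ.isFC b, fun f hf l hl =>
      (wnorm_mulFam_le φ.isFC ψ.isFC hb h₀ f hl).trans_lt <| ENNReal.sum_lt_top.2 fun j hj => by
        have hj' : j ≤ l := Nat.lt_succ_iff.1 (Finset.mem_range.1 hj)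
        refine ENNReal.mul_lt_top (by simp) (ENNReal.mul_lt_top (φ.wnorm_lt_top hf₀ ?_)
          (ψ.wnorm_lt_top hf ?_))
        · exact le_trans (by exact_mod_cast hj') hl
        · exact le_trans (by exact_mod_cast Nat.sub_le l j) hl⟩)
    (fun _ _ _ => by ext1; simp [mulFam]; rfl)
    (fun _ _ _ => by ext1; simp [mulFam]; rfl)
    (fun _ _ _ => by ext1; simp [mulFam]; rfl)
    (fun _ _ _ => by ext1; simp [mulFam]; rfl)

variable {b : ∀ i, A i →L[𝕜] B i →L[𝕜] Z i} {hb : ∀ i, ‖b i‖ ≤ 1} {hf₀ : f₀ ∈ 𝒲}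
  {h₀ : ∀ p, 1 ≤ wabs (f₀ p)}

@[simp] lemma mul_apply (φ : RProd 𝕜 U A 𝒲 k) (ψ : RProd 𝕜 U B 𝒲 k) (i : I) (x : U i) :
    mul b hb hf₀ h₀ φ ψ i x = b i (φ i x) (ψ i x) := rfl

lemma continuous_mul : Continuous fun p : RProd 𝕜 U A 𝒲 k × RProd 𝕜 U B 𝒲 k =>
    mul b hb hf₀ h₀ p.1 p.2 := by
  refine continuous_iff_continuousAt.2 fun p => ?_
  -- a product tends to zero if one factor does and the other one converges to zero or is constant
  have aux : ∀ (u : RProd 𝕜 U A 𝒲 k × RProd 𝕜 U B 𝒲 k → RProd 𝕜 U A 𝒲 k)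
      (v : RProd 𝕜 U A 𝒲 k × RProd 𝕜 U B 𝒲 k → RProd 𝕜 U B 𝒲 k)
      (φ : RProd 𝕜 U A 𝒲 k) (ψ : RProd 𝕜 U B 𝒲 k),
      (∀ f ∈ 𝒲, ∀ j : ℕ, (j : ℕ∞) ≤ k →
        Tendsto (fun q => wnorm 𝕜 f j (u q).1) (𝓝 p) (𝓝 (wnorm 𝕜 f j φ.1))) →
      (∀ f ∈ 𝒲, ∀ j : ℕ, (j : ℕ∞) ≤ k →
        Tendsto (fun q => wnorm 𝕜 f j (v q).1) (𝓝 p) (𝓝 (wnorm 𝕜 f j ψ.1))) →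
      φ = 0 ∨ ψ = 0 →
      Tendsto (fun q => mul b hb hf₀ h₀ (u q) (v q)) (𝓝 p) (𝓝 0) := by
    intro u v φ ψ hu hv h0
    refine tendsto_iff.2 fun f hf l hl => ?_
    have hlim : Tendsto (fun q => ∑ j ∈ Finset.range (l + 1), (l.choose j : ℝ≥0∞) *
        (wnorm 𝕜 f₀ j (u q).1 * wnorm 𝕜 f (l - j) (v q).1)) (𝓝 p)
        (𝓝 (∑ j ∈ Finset.range (l + 1), (l.choose j : ℝ≥0∞) *
        (wnorm 𝕜 f₀ j φ.1 * wnorm 𝕜 f (l - j) ψ.1))) := by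
      refine tendsto_finsetSum _ fun j hj => ?_
      have hj' : j ≤ l := Nat.lt_succ_iff.1 (Finset.mem_range.1 hj)
      have h1 : (j : ℕ∞) ≤ k := le_trans (by exact_mod_cast hj') hl
      have h2 : ((l - j : ℕ) : ℕ∞) ≤ k := le_trans (by exact_mod_cast Nat.sub_le l j) hl
      refine ENNReal.Tendsto.const_mul (ENNReal.Tendsto.mul (hu f₀ hf₀ j h1)
        (Or.inr (ψ.wnorm_lt_top hf h2).ne) (hv f hf _ h2)
        (Or.inr (φ.wnorm_lt_top hf₀ h1).ne)) (Or.inr (by simp))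
    have hz : (∑ j ∈ Finset.range (l + 1), (l.choose j : ℝ≥0∞) *
        (wnorm 𝕜 f₀ j φ.1 * wnorm 𝕜 f (l - j) ψ.1)) = 0 := by
      refine Finset.sum_eq_zero fun j _ => ?_
      have hA : wnorm 𝕜 f₀ j (0 : RProd 𝕜 U A 𝒲 k).1 = 0 := wnorm_zero 𝕜 U A f₀ j
      have hB : wnorm 𝕜 f (l - j) (0 : RProd 𝕜 U B 𝒲 k).1 = 0 := wnorm_zero 𝕜 U B f (l - j)
      rcases h0 with h | h
      · rw [h, hA, zero_mul, mul_zero]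
      · rw [h, hB, mul_zero, mul_zero]
    rw [hz] at hlim
    refine tendsto_of_tendsto_of_tendsto_of_le_of_le tendsto_const_nhds hlim
      (fun _ => zero_le) fun q => ?_
    simp only [sub_zero]
    exact wnorm_mulFam_le (u q).isFC (v q).isFC hb h₀ f hl
  have zA : ∀ (f : (Σ i, U i) → WithTop ℝ) (j : ℕ), wnorm 𝕜 f j (0 : RProd 𝕜 U A 𝒲 k).1 = 0 :=
    fun f j => wnorm_zero 𝕜 U A f j
  have zB : ∀ (f : (Σ i, U i) → WithTop ℝ) (j : ℕ), wnorm 𝕜 f j (0 : RProd 𝕜 U B 𝒲 k).1 = 0 :=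
    fun f j => wnorm_zero 𝕜 U B f j
  have hfst := tendsto_iff.1 (continuous_fst.tendsto p)
  have hsnd := tendsto_iff.1 (continuous_snd.tendsto p)
  -- q₁q₂ − p₁p₂ = (q₁ − p₁)(q₂ − p₂) + (q₁ − p₁)p₂ + p₁(q₂ − p₂), and each summand tends to 0.
  have e1 := aux (fun q => q.1 - p.1) (fun q => q.2 - p.2) 0 0
    (fun f hf j hj => by simpa only [zA] using hfst f hf j hj)
    (fun f hf j hj => by simpa only [zB] using hsnd f hf j hj) (Or.inl rfl)
  have e2 := aux (fun q => q.1 - p.1) (fun q => p.2) 0 p.2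
    (fun f hf j hj => by simpa only [zA] using hfst f hf j hj)
    (fun f hf j hj => tendsto_const_nhds) (Or.inl rfl)
  have e3 := aux (fun q => p.1) (fun q => q.2 - p.2) p.1 0
    (fun f hf j hj => tendsto_const_nhds)
    (fun f hf j hj => by simpa only [zB] using hsnd f hf j hj) (Or.inr rfl)
  have := ((e1.add e2).add e3).add_const (mul b hb hf₀ h₀ p.1 p.2)
  rw [add_zero, add_zero, zero_add] at this
  refine this.congr fun q => ?_
  simp only [map_sub, LinearMap.sub_apply]
  abel

end RProd

end Topology

/-! ### Simultaneous composition -/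

/-! ### The mean value inequality along a segment -/

section MeanValue

variable {𝕜 : Type*} [RCLike 𝕜] {A B : Type*} [NormedAddCommGroup A] [NormedSpace 𝕜 A]
  [NormedAddCommGroup B] [NormedSpace 𝕜 B]

/-- Only the segment has to lie where G is differentiable, since W_i is not assumed convex. The
bound M = ∞ is allowed, with ∞ · 0 = 0. -/
lemma enorm_sub_le_of_segment {G : A → B} {a v : A} {M : ℝ≥0∞}
    (hd : ∀ s ∈ Icc (0 : ℝ) 1, DifferentiableAt 𝕜 G (a + (s : 𝕜) • v))
    (hM : ∀ s ∈ Icc (0 : ℝ) 1, ‖fderiv 𝕜 G (a + (s : 𝕜) • v)‖ₑ ≤ M) :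
    ‖G (a + v) - G a‖ₑ ≤ M * ‖v‖ₑ := by
  let _ : NormedSpace ℝ A := NormedSpace.restrictScalars ℝ 𝕜 A
  rcases eq_or_ne M ⊤ with rfl | hMt
  · rcases eq_or_ne v 0 with rfl | hv
    · simp
    · rw [ENNReal.top_mul (by simpa using hv)]
      exact le_top
  have hsmul : ∀ s : ℝ, s • v = (s : 𝕜) • v := fun s => by
    rw [← algebraMap_smul 𝕜 s v, RCLike.algebraMap_eq_ofReal]
  have hseg : ∀ y ∈ segment ℝ a (a + v), ∃ s ∈ Icc (0 : ℝ) 1, y = a + (s : 𝕜) • v := by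
    intro y hy
    rw [segment_eq_image'] at hy
    obtain ⟨s, hs, rfl⟩ := hy
    exact ⟨s, hs, by simp only [add_sub_cancel_left, hsmul]⟩
  have h := (convex_segment (𝕜 := ℝ) a (a + v)).norm_image_sub_le_of_norm_fderiv_le (𝕜 := 𝕜)
    (f := G) (C := M.toReal) (x := a) (y := a + v)
    (fun y hy => by obtain ⟨s, hs, rfl⟩ := hseg y hy; exact hd s hs)
    (fun y hy => by
      obtain ⟨s, hs, rfl⟩ := hseg y hy
      rw [← toReal_enorm]
      exact ENNReal.toReal_mono hMt (hM s hs))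
    (left_mem_segment ℝ _ _) (right_mem_segment ℝ _ _)
  rw [add_sub_cancel_left] at h
  rw [← ofReal_norm, ← ofReal_norm, ← ENNReal.ofReal_toReal hMt,
    ← ENNReal.ofReal_mul ENNReal.toReal_nonneg]
  exact ENNReal.ofReal_le_ofReal h

lemma norm_iteratedFDeriv_id_le {j : ℕ} (hj : 1 ≤ j) (x : A) :
    ‖iteratedFDeriv 𝕜 j (fun y : A => y) x‖ ≤ 1 := by
  obtain ⟨j, rfl⟩ := Nat.exists_eq_add_of_le' hj
  rw [← norm_iteratedFDeriv_fderiv]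
  have h : fderiv 𝕜 (fun y : A => y) = fun _ => ContinuousLinearMap.id 𝕜 A :=
    funext fun y => fderiv_fun_id
  rw [h]
  rcases Nat.eq_zero_or_pos j with rfl | hj'
  · rw [norm_iteratedFDeriv_zero]
    exact ContinuousLinearMap.norm_id_le
  · rw [iteratedFDeriv_const_of_ne hj'.ne']
    simp

end MeanValue

/-! ### Composition with η + id: setting and well-definedness -/

section Composition

variable {𝕜 : Type*} [RCLike 𝕜] {I : Type*}
  {X : I → Type*} [∀ i, NormedAddCommGroup (X i)] [∀ i, NormedSpace 𝕜 (X i)]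
  {Y : I → Type*} [∀ i, NormedAddCommGroup (Y i)] [∀ i, NormedSpace 𝕜 (Y i)]

/-- The hypotheses under which simultaneous composition is studied. -/
structure CompData (𝕜 : Type*) [RCLike 𝕜] {I : Type*} {X : I → Type*}
    [∀ i, NormedAddCommGroup (X i)] [∀ i, NormedSpace 𝕜 (X i)]
    (U V W : ∀ i, TopologicalSpace.Opens (X i)) (𝒲 : Set ((Σ i, W i) → WithTop ℝ))
    (ω : (Σ i, W i) → ℝ) : Prop where
  le : ∀ i, U i ≤ W i
  add_mem : ∀ i, ∀ x ∈ U i, ∀ v ∈ V i, x + v ∈ W i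
  nonempty : ∀ i, (V i : Set (X i)).Nonempty
  balanced : ∀ i, Balanced 𝕜 (V i : Set (X i))
  mem : (fun p => (ω p : WithTop ℝ)) ∈ 𝒲
  one_le : ∀ p, 1 ≤ |ω p|

/-- The compositions `γ_i ∘ (η_i + id)`, for maps `γ_i` extended by zero. -/
def compFam {U W : ∀ i, TopologicalSpace.Opens (X i)} (γ : ∀ i, W i → Y i)
    (η : ∀ i, U i → X i) : ∀ i, U i → Y i :=
  fun i x => zeroExt (γ i) (η i x + (x : X i))

namespace CompData

variable {U V W : ∀ i, TopologicalSpace.Opens (X i)} {𝒲 : Set ((Σ i, W i) → WithTop ℝ)}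
  {ω : (Σ i, W i) → ℝ} (H : CompData 𝕜 U V W 𝒲 ω) {k m : ℕ∞}

/-- The weight `ω`, with values in `ℝ ∪ {∞}`, on the disjoint union of the `W_i`. -/
def wW (_ : CompData 𝕜 U V W 𝒲 ω) : (Σ i, W i) → WithTop ℝ := fun p => (ω p : WithTop ℝ)

/-- The weight `ω`, with values in `ℝ ∪ {∞}`, on the disjoint union of the `U_i`. -/
def wU : (Σ i, U i) → WithTop ℝ := restrictFun H.le H.wW

/-- The restricted weights. -/
abbrev 𝒲U : Set ((Σ i, U i) → WithTop ℝ) := restrictFun H.le '' 𝒲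

/-- The domain of the second argument of the composition map. -/
abbrev Ω (k : ℕ∞) : Set (RProd 𝕜 U X H.𝒲U k) :=
  omegaSet X (fun i => (V i : Set (X i))) (restrictFun H.le ω)

lemma wW_mem : H.wW ∈ 𝒲 := H.mem

lemma wU_mem : H.wU ∈ H.𝒲U := ⟨_, H.mem, rfl⟩

lemma one_le_wW (p : Σ i, W i) : 1 ≤ wabs (H.wW p) := by
  change 1 ≤ ‖ω p‖ₑ
  rw [← ofReal_norm, Real.norm_eq_abs]
  exact ENNReal.one_le_ofReal.2 (H.one_le p)

lemma one_le_wU (p : Σ i, U i) : 1 ≤ wabs (H.wU p) := H.one_le_wW _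

include H in
lemma zero_mem (i : I) : (0 : X i) ∈ V i := (H.balanced i).zero_mem (H.nonempty i)

include H in
lemma smul_mem {i : I} {v : X i} (hv : v ∈ V i) {s : ℝ} (hs : s ∈ Icc (0 : ℝ) 1) :
    (s : 𝕜) • v ∈ V i :=
  (H.balanced i).smul_mem (by rw [RCLike.norm_ofReal, abs_of_nonneg hs.1]; exact hs.2) hv

include H in
lemma pos (p : Σ i, W i) : 0 < |ω p| := zero_lt_one.trans_le (H.one_le p)

/-- The radii r / |ω(x)| in the definition of Ω are matched to the seminorm ‖·‖_{ω,0}. -/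
lemma norm_lt_of_wnorm_lt {ζ : ∀ i, U i → X i} {r : ℝ}
    (h : wnorm 𝕜 H.wU 0 ζ < ENNReal.ofReal r) (i : I) (x : U i) :
    ‖ζ i x‖ < r / |restrictFun H.le ω ⟨i, x⟩| := by
  have h1 := (mul_enorm_le_wnorm (𝕜 := 𝕜) H.wU ζ i x).trans_lt h
  change ‖restrictFun H.le ω ⟨i, x⟩‖ₑ * _ < _ at h1
  rw [← ofReal_norm, ← ofReal_norm, ← ENNReal.ofReal_mul (norm_nonneg _)] at h1
  have hp : 0 < |restrictFun H.le ω ⟨i, x⟩| := H.pos _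
  rw [lt_div_iff₀ hp, mul_comm]
  exact (ENNReal.ofReal_lt_ofReal_iff'.1 h1).1

lemma add_smul_mem {η ζ : ∀ i, U i → X i} {r : ℝ}
    (hη : ∀ (i : I) (x : U i),
      Metric.ball (η i x) (r / |restrictFun H.le ω ⟨i, x⟩|) ⊆ (V i : Set (X i)))
    (h : wnorm 𝕜 H.wU 0 ζ < ENNReal.ofReal r) (i : I) (x : U i) {s : ℝ}
    (hs : s ∈ Icc (0 : ℝ) 1) : η i x + (s : 𝕜) • ζ i x ∈ V i := by
  refine hη i x ?_
  rw [mem_ball_iff_norm, add_sub_cancel_left, norm_smul, RCLike.norm_ofReal, abs_of_nonneg hs.1]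
  exact (mul_le_of_le_one_left (norm_nonneg _) hs.2).trans_lt (H.norm_lt_of_wnorm_lt h i x)

lemma mem_of_mem_Ω {η : RProd 𝕜 U X H.𝒲U k} (hη : η ∈ H.Ω k) (i : I) (x : U i) : η i x ∈ V i := by
  obtain ⟨r, hr, h⟩ := hη
  exact h i x (Metric.mem_ball_self (div_pos hr (H.pos _)))

/-- If r works for η, then r/2 works for every ζ with ‖ζ − η‖_{ω,0} < r/2, by the triangle
inequality. -/
lemma isOpen_Ω (k : ℕ∞) : IsOpen (H.Ω k) := by
  refine isOpen_iff_mem_nhds.2 fun η ⟨r, hr, h⟩ => ?_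
  have hlim := RProd.tendsto_iff.1 (tendsto_id (x := 𝓝 η)) H.wU H.wU_mem 0 (by simp)
  filter_upwards [hlim.eventually_lt_const (ENNReal.ofReal_pos.2 (half_pos hr))] with ζ hζ
  refine ⟨r / 2, half_pos hr, fun i x => (Metric.ball_subset_ball' ?_).trans (h i x)⟩
  have h1 := H.norm_lt_of_wnorm_lt hζ i x
  have h2 : dist (ζ i x) (η i x) < r / 2 / |restrictFun H.le ω ⟨i, x⟩| := by
    rw [dist_eq_norm]
    exact h1
  rw [div_right_comm] at h2 ⊢
  linarith

include H in
lemma add_coe_mem {i : I} {v : X i} (hv : v ∈ V i) (x : U i) : v + (x : X i) ∈ W i := by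
  rw [add_comm]
  exact H.add_mem i x x.2 v hv

/-! #### Estimates -/

/-- Translation by x ∈ U_i moves a segment in V_i into W_i, where ‖γ‖_{ω,j+1} bounds the derivative
of D^jγ. -/
lemma enorm_iteratedFDeriv_sub_le {γ : ∀ i, W i → Y i} (hγ : IsFC 𝕜 m γ) {j : ℕ}
    (hj : ((j + 1 : ℕ) : ℕ∞) ≤ m) {i : I} (x : U i) {a v : X i}
    (hav : ∀ s ∈ Icc (0 : ℝ) 1, a + (s : 𝕜) • v ∈ V i) :
    ‖iteratedFDeriv 𝕜 j (zeroExt (γ i)) (a + v + x)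
      - iteratedFDeriv 𝕜 j (zeroExt (γ i)) (a + x)‖ₑ ≤ wnorm 𝕜 H.wW (j + 1) γ * ‖v‖ₑ := by
  have hW : ∀ s ∈ Icc (0 : ℝ) 1, a + x + (s : 𝕜) • v ∈ W i := fun s hs => by
    rw [add_right_comm]
    exact H.add_coe_mem (hav s hs) x
  rw [add_right_comm]
  refine enorm_sub_le_of_segment (𝕜 := 𝕜) (fun s hs => ?_) fun s hs => ?_
  · exact (hγ.contDiffAt hj i ⟨_, hW s hs⟩).differentiableAt_iteratedFDeriv
      (by exact_mod_cast Nat.lt_succ_self j)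
  · rw [← ofReal_norm, norm_fderiv_iteratedFDeriv, ofReal_norm]
    exact le_wnorm_of_one_le H.one_le_wW (j + 1) γ i ⟨_, hW s hs⟩

lemma enorm_sub_le {γ : ∀ i, W i → Y i} (hγ : IsFC 𝕜 m γ) (hm : 1 ≤ m) {i : I} (x : U i)
    {a v : X i} (hav : ∀ s ∈ Icc (0 : ℝ) 1, a + (s : 𝕜) • v ∈ V i) :
    ‖zeroExt (γ i) (a + v + x) - zeroExt (γ i) (a + x)‖ₑ ≤ wnorm 𝕜 H.wW 1 γ * ‖v‖ₑ := by
  have hW : ∀ s ∈ Icc (0 : ℝ) 1, a + x + (s : 𝕜) • v ∈ W i := fun s hs => by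
    rw [add_right_comm]
    exact H.add_coe_mem (hav s hs) x
  rw [add_right_comm]
  refine enorm_sub_le_of_segment (𝕜 := 𝕜)
    (fun s hs => hγ.differentiableAt hm i ⟨_, hW s hs⟩) fun s hs => ?_
  have h := le_wnorm_of_one_le (𝕜 := 𝕜) H.one_le_wW 1 γ i ⟨_, hW s hs⟩
  rwa [← ofReal_norm, norm_iteratedFDeriv_one, ofReal_norm] at h

/-- Comparison with the value at x: the segment from 0 to η_i(x) lies in the balanced set V_i. The
weight f(x) goes to D^jγ(x) in one term and to η(x) in the other, so f is never compared at two
different points. This is where the extra derivative of γ is spent. -/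
lemma mul_enorm_iteratedFDeriv_le {γ : ∀ i, W i → Y i} (hγ : IsFC 𝕜 m γ) {j : ℕ}
    (hj : ((j + 1 : ℕ) : ℕ∞) ≤ m) (f : (Σ i, W i) → WithTop ℝ) {η : ∀ i, U i → X i} {i : I}
    {x : U i} (hη : η i x ∈ V i) :
    wabs (restrictFun H.le f ⟨i, x⟩) * ‖iteratedFDeriv 𝕜 j (zeroExt (γ i)) (η i x + x)‖ₑ ≤
      wnorm 𝕜 f j γ + wnorm 𝕜 H.wW (j + 1) γ * wnorm 𝕜 (restrictFun H.le f) 0 η := by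
  have h1 := H.enorm_iteratedFDeriv_sub_le hγ hj x (a := 0) (v := η i x)
    fun s hs => by rw [zero_add]; exact H.smul_mem hη hs
  rw [zero_add, zero_add] at h1
  have h2 : ‖iteratedFDeriv 𝕜 j (zeroExt (γ i)) (η i x + x)‖ₑ ≤
      ‖iteratedFDeriv 𝕜 j (zeroExt (γ i)) x‖ₑ + wnorm 𝕜 H.wW (j + 1) γ * ‖η i x‖ₑ := by
    calc _ = ‖iteratedFDeriv 𝕜 j (zeroExt (γ i)) x +
          (iteratedFDeriv 𝕜 j (zeroExt (γ i)) (η i x + x)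
            - iteratedFDeriv 𝕜 j (zeroExt (γ i)) x)‖ₑ := by rw [add_sub_cancel]
      _ ≤ _ := (enorm_add_le (iteratedFDeriv 𝕜 j (zeroExt (γ i)) (x : X i)) _).trans
          (by gcongr)
  refine (mul_le_mul_right h2 _).trans ?_
  rw [mul_add, mul_left_comm]
  gcongr
  · exact le_wnorm f j γ i ⟨x, H.le i x.2⟩
  · exact mul_enorm_le_wnorm (restrictFun H.le f) η i x

lemma mul_enorm_compFam_le {γ : ∀ i, W i → Y i} (hγ : IsFC 𝕜 m γ) (hm : 1 ≤ m)
    (f : (Σ i, W i) → WithTop ℝ) {η : ∀ i, U i → X i} {i : I} {x : U i} (hη : η i x ∈ V i) :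
    wabs (restrictFun H.le f ⟨i, x⟩) * ‖compFam γ η i x‖ₑ ≤
      wnorm 𝕜 f 0 γ + wnorm 𝕜 H.wW 1 γ * wnorm 𝕜 (restrictFun H.le f) 0 η := by
  have h := H.mul_enorm_iteratedFDeriv_le hγ (j := 0) (by exact_mod_cast hm) f hη
  rwa [enorm_iteratedFDeriv_zero] at h

/-! #### The composition map -/

lemma zeroExt_compFam_eqOn (γ : ∀ i, W i → Y i) (η : ∀ i, U i → X i) (i : I) :
    EqOn (zeroExt (compFam γ η i)) (zeroExt (γ i) ∘ fun y => zeroExt (η i) y + y)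
      (U i : Set (X i)) :=
  zeroExt_eqOn fun x => by simp [compFam]

include H in
lemma mapsTo {η : ∀ i, U i → X i} (hη : ∀ i x, η i x ∈ V i) (i : I) :
    MapsTo (fun y => zeroExt (η i) y + y) (U i : Set (X i)) (W i : Set (X i)) := fun y hy => by
  have h := H.add_coe_mem (hη i ⟨y, hy⟩) ⟨y, hy⟩
  rwa [← zeroExt_of_mem (η i) hy] at h

include H in
lemma isFC_compFam {γ : ∀ i, W i → Y i} {η : ∀ i, U i → X i} (hγ : IsFC 𝕜 k γ)
    (hη : IsFC 𝕜 k η) (hηV : ∀ i x, η i x ∈ V i) : IsFC 𝕜 k (compFam γ η) := fun i =>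
  ((hγ i).comp ((hη i).add contDiffOn_id) (H.mapsTo hηV i)).congr (zeroExt_compFam_eqOn γ η i)

lemma wnorm_compFam_lt_top (γ : RProd 𝕜 W Y 𝒲 m) (η : RProd 𝕜 U X H.𝒲U k) (hm : k + 1 ≤ m)
    (hηV : ∀ i x, η i x ∈ V i) {f : (Σ i, W i) → WithTop ℝ} (hf : f ∈ 𝒲) {l : ℕ}
    (hl : (l : ℕ∞) ≤ k) : wnorm 𝕜 (restrictFun H.le f) l (compFam γ.1 η.1) < ⊤ := by
  have hfU : restrictFun H.le f ∈ H.𝒲U := ⟨f, hf, rfl⟩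
  have hk : k ≤ m := le_trans le_self_add hm
  -- A uniform bound for the derivatives of η + id of orders 1 to l; the summand 1 accounts for id.
  -- Since D ≥ 1, it is also at most D^j, as the Faà di Bruno bound requires.
  set D : ℝ := 1 + ∑ j ∈ Finset.range (l + 1), (wnorm 𝕜 H.wU j η.1).toReal
  have hD1 : 1 ≤ D := le_add_of_nonneg_right (Finset.sum_nonneg fun _ _ => ENNReal.toReal_nonneg)
  have hle : ∀ {j : ℕ}, j ∈ Finset.range (l + 1) → (j : ℕ∞) ≤ k := fun {j} hj =>
    le_trans (by exact_mod_cast Nat.lt_succ_iff.1 (Finset.mem_range.1 hj)) hl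
  have hle' : ∀ {j : ℕ}, j ∈ Finset.range (l + 1) → ((j + 1 : ℕ) : ℕ∞) ≤ m := fun {j} hj =>
    le_trans (by push_cast; gcongr; exact hle hj) hm
  have hbound : wnorm 𝕜 (restrictFun H.le f) l (compFam γ.1 η.1) ≤
      ENNReal.ofReal (l.factorial * D ^ l) * ∑ j ∈ Finset.range (l + 1),
        (wnorm 𝕜 f j γ.1 + wnorm 𝕜 H.wW (j + 1) γ.1 * wnorm 𝕜 (restrictFun H.le f) 0 η.1) := by
    refine iSup₂_le fun i x => ?_
    have hcomp := norm_iteratedFDerivWithin_comp_le (n := l) (x := (x : X i))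
      ((γ.isFC i).of_le (m := k) (by exact_mod_cast hk))
      ((η.isFC i).add contDiffOn_id)
      (by exact_mod_cast hl) (W i).isOpen.uniqueDiffOn (U i).isOpen.uniqueDiffOn
      (H.mapsTo hηV i) x.2
      -- C depends on x instead of being a supremum, because it still has to be multiplied by
      -- |f(x)|.
      (C := ∑ j ∈ Finset.range (l + 1), ‖iteratedFDeriv 𝕜 j (zeroExt (γ i)) (η i x + x)‖)
      (D := D)
      (fun j hj => by
        refine (congrArg norm (iteratedFDerivWithin_of_isOpen j (W i).isOpen
          (H.mapsTo hηV i x.2))).trans_le ?_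
        change ‖iteratedFDeriv 𝕜 j (zeroExt (γ i)) (zeroExt (η i) (x : X i) + x)‖ ≤ _
        rw [zeroExt_coe]
        exact Finset.single_le_sum
          (f := fun j => ‖iteratedFDeriv 𝕜 j (zeroExt (γ i)) (η i x + x)‖)
          (fun _ _ => norm_nonneg _) (Finset.mem_range.2 (Nat.lt_succ_of_le hj)))
      (fun j hj1 hj => by
        have hj' := Finset.mem_range.2 (Nat.lt_succ_of_le hj)
        refine le_trans ?_ (le_self_pow₀ hD1 (by omega))
        rw [iteratedFDerivWithin_of_isOpen _ (U i).isOpen x.2]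
        have hadd := iteratedFDeriv_add_apply (x := (x : X i))
          (η.isFC.contDiffAt (hle hj') i x) (contDiffAt_id (𝕜 := 𝕜) (n := j))
        have h1 : ‖iteratedFDeriv 𝕜 j (zeroExt (η i)) (x : X i)‖ ≤
            ∑ j ∈ Finset.range (l + 1), (wnorm 𝕜 H.wU j η.1).toReal := by
          refine le_trans ?_ (Finset.single_le_sum
            (f := fun j => (wnorm 𝕜 H.wU j η.1).toReal)
            (fun _ _ => ENNReal.toReal_nonneg) hj')
          rw [← toReal_enorm]
          exact ENNReal.toReal_mono (η.wnorm_lt_top H.wU_mem (hle hj')).ne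
            (le_wnorm_of_one_le H.one_le_wU j η.1 i x)
        change ‖iteratedFDeriv 𝕜 j (zeroExt (η i) + id) (x : X i)‖ ≤ D
        rw [hadd]
        exact (norm_add_le _ _).trans
          ((add_le_add h1 (norm_iteratedFDeriv_id_le hj1 _)).trans_eq (add_comm _ _)))
    rw [iteratedFDerivWithin_of_isOpen _ (U i).isOpen x.2] at hcomp
    have heq := ((zeroExt_compFam_eqOn γ.1 η.1 i).eventuallyEq_of_mem
      ((U i).isOpen.mem_nhds x.2)).iteratedFDeriv 𝕜 l
    rw [heq.self_of_nhds, ← ofReal_norm]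
    refine (mul_le_mul_right (ENNReal.ofReal_le_ofReal hcomp) _).trans ?_
    rw [mul_right_comm, ENNReal.ofReal_mul (by positivity),
      ENNReal.ofReal_sum_of_nonneg fun _ _ => norm_nonneg _, mul_left_comm, Finset.mul_sum]
    gcongr with j hj
    rw [ofReal_norm]
    exact H.mul_enorm_iteratedFDeriv_le γ.isFC (hle' hj) f (hηV i x)
  refine hbound.trans_lt (ENNReal.mul_lt_top ENNReal.ofReal_lt_top
    (ENNReal.sum_lt_top.2 fun j hj => ENNReal.add_lt_top.2
      ⟨γ.wnorm_lt_top hf ((hle hj).trans hk), ENNReal.mul_lt_top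
        (γ.wnorm_lt_top H.wW_mem (hle' hj)) (η.wnorm_lt_top hfU (by simp))⟩))

open Classical in
/-- The simultaneous composition map `(γ, η) ↦ (γ_i ∘ (η_i + id))_i` on `C^m × Ω`, extended by
zero. -/
def comp (hm : k + 1 ≤ m) (p : RProd 𝕜 W Y 𝒲 m × RProd 𝕜 U X H.𝒲U k) : RProd 𝕜 U Y H.𝒲U k :=
  if h : p.2 ∈ H.Ω k then
    ⟨compFam p.1.1 p.2.1,
      H.isFC_compFam (fun i => (p.1.isFC i).of_le (by exact_mod_cast le_self_add.trans hm)) p.2.isFC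
        (H.mem_of_mem_Ω h),
      by
        rintro _ ⟨f, hf, rfl⟩ l hl
        exact H.wnorm_compFam_lt_top p.1 p.2 hm (H.mem_of_mem_Ω h) hf hl⟩
  else 0

lemma comp_apply (hm : k + 1 ≤ m) (γ : RProd 𝕜 W Y 𝒲 m) {η : RProd 𝕜 U X H.𝒲U k}
    (hη : η ∈ H.Ω k) (i : I) (x : U i) :
    H.comp hm (γ, η) i x = zeroExt (γ i) (η i x + x) := by
  have h : H.comp hm (γ, η) = _ := dif_pos hη
  rw [h]
  rfl

end CompData

end Composition

section Differentiability

namespace CompData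

universe uI uX uY

variable {𝕜 : Type*} [RCLike 𝕜] {I : Type uI}
  {X : I → Type uX} [∀ i, NormedAddCommGroup (X i)] [∀ i, NormedSpace 𝕜 (X i)]
  {Y : I → Type uY} [∀ i, NormedAddCommGroup (Y i)] [∀ i, NormedSpace 𝕜 (Y i)]
  {U V W : ∀ i, TopologicalSpace.Opens (X i)} {𝒲 : Set ((Σ i, W i) → WithTop ℝ)}
  {ω : (Σ i, W i) → ℝ} (H : CompData 𝕜 U V W 𝒲 ω) {k m : ℕ∞}

/-! #### Continuity and differentiability for `k = 0` -/

/-- The difference is [γ ∘ (η + id) − γ ∘ (η₀ + id)] + (γ − γ₀) ∘ (η₀ + id). In the first part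
‖γ‖_{ω,1} is replaced by ‖γ − γ₀‖_{ω,1} + ‖γ₀‖_{ω,1}, so that the bound visibly tends to 0 at (γ₀,
η₀). -/
lemma wnorm_compFam_sub_le {γ γ₀ : ∀ i, W i → Y i} (hγ : IsFC 𝕜 m γ) (hγ₀ : IsFC 𝕜 m γ₀)
    (hm : 1 ≤ m) {η η₀ : ∀ i, U i → X i} {r : ℝ}
    (hη₀ : ∀ (i : I) (x : U i),
      Metric.ball (η₀ i x) (r / |restrictFun H.le ω ⟨i, x⟩|) ⊆ (V i : Set (X i)))
    (hη₀V : ∀ i x, η₀ i x ∈ V i) (hr : wnorm 𝕜 H.wU 0 (η - η₀) < ENNReal.ofReal r)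
    (f : (Σ i, W i) → WithTop ℝ) :
    wnorm 𝕜 (restrictFun H.le f) 0 (compFam γ η - compFam γ₀ η₀) ≤
      (wnorm 𝕜 H.wW 1 (γ - γ₀) + wnorm 𝕜 H.wW 1 γ₀) *
          wnorm 𝕜 (restrictFun H.le f) 0 (η - η₀) +
        (wnorm 𝕜 f 0 (γ - γ₀) +
          wnorm 𝕜 H.wW 1 (γ - γ₀) * wnorm 𝕜 (restrictFun H.le f) 0 η₀) := by
  have hsub : IsFC 𝕜 m (γ - γ₀) := fun i => by
    have h : γ i - γ₀ i = γ i + (-1 : 𝕜) • γ₀ i := by rw [neg_one_smul, sub_eq_add_neg]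
    rw [Pi.sub_apply, h, zeroExt_add, zeroExt_smul]
    exact (hγ i).add ((hγ₀ i).const_smul _)
  have hγle : wnorm 𝕜 H.wW 1 γ ≤ wnorm 𝕜 H.wW 1 (γ - γ₀) + wnorm 𝕜 H.wW 1 γ₀ := by
    simpa using wnorm_add_le hsub hγ₀ H.wW (ℓ := 1) (by exact_mod_cast hm)
  rw [wnorm_zero_eq]
  refine iSup₂_le fun i x => ?_
  have h1 := H.enorm_sub_le hγ hm x (a := η₀ i x) (v := (η - η₀) i x)
    fun s hs => H.add_smul_mem hη₀ hr i x hs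
  have h2 := H.mul_enorm_compFam_le hsub hm f (hη₀V i x)
  have hsplit : (compFam γ η - compFam γ₀ η₀) i x =
      (zeroExt (γ i) (η₀ i x + (η - η₀) i x + x) - zeroExt (γ i) (η₀ i x + x))
        + compFam (γ - γ₀) η₀ i x := by
    have hW := H.add_coe_mem (hη₀V i x) x
    simp only [Pi.sub_apply, compFam, add_sub_cancel]
    rw [zeroExt_of_mem (γ i - γ₀ i) hW, zeroExt_of_mem (γ i) hW, zeroExt_of_mem (γ₀ i) hW,
      Pi.sub_apply]
    abel
  rw [hsplit]
  refine (mul_le_mul_right (enorm_add_le _ _) _).trans ?_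
  rw [mul_add]
  refine add_le_add ?_ h2
  refine (mul_le_mul_right (h1.trans (mul_le_mul_left hγle _)) _).trans ?_
  rw [mul_left_comm]
  gcongr
  exact mul_enorm_le_wnorm (restrictFun H.le f) (η - η₀) i x

lemma coe_comp (hm : k + 1 ≤ m) (γ : RProd 𝕜 W Y 𝒲 m) {η : RProd 𝕜 U X H.𝒲U k}
    (hη : η ∈ H.Ω k) : (H.comp hm (γ, η)).1 = compFam γ.1 η.1 :=
  funext fun i => funext fun x => H.comp_apply hm γ hη i x

lemma continuousOn_comp_zero (hm : 0 + 1 ≤ m) :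
    ContinuousOn (H.comp (Y := Y) hm) (univ ×ˢ H.Ω 0) := by
  rintro ⟨γ₀, η₀⟩ ⟨-, hη₀⟩
  have hm' : 1 ≤ m := by simpa using hm
  refine RProd.tendsto_iff.2 ?_
  rintro _ ⟨f, hf, rfl⟩ j hj
  obtain rfl : j = 0 := by simpa using hj
  obtain ⟨r, hr, hball⟩ := id hη₀
  have hfU : restrictFun H.le f ∈ H.𝒲U := ⟨f, hf, rfl⟩
  have hγ := RProd.tendsto_iff.1 (((continuous_fst (X := RProd 𝕜 W Y 𝒲 m)).tendsto
    (γ₀, η₀)).mono_left (nhdsWithin_le_nhds (s := univ ×ˢ H.Ω 0)))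
  have hη := RProd.tendsto_iff.1 (((continuous_snd (X := RProd 𝕜 W Y 𝒲 m)).tendsto
    (γ₀, η₀)).mono_left (nhdsWithin_le_nhds (s := univ ×ˢ H.Ω 0)))
  have ha := hγ H.wW H.wW_mem 1 (by exact_mod_cast hm')
  have hb := hη (restrictFun H.le f) hfU 0 (by simp)
  have hc := hγ f hf 0 (by simp)
  have hA : wnorm 𝕜 H.wW 1 γ₀.1 ≠ ⊤ := (γ₀.wnorm_lt_top H.wW_mem (by exact_mod_cast hm')).ne
  have hB : wnorm 𝕜 (restrictFun H.le f) 0 η₀.1 ≠ ⊤ := (η₀.wnorm_lt_top hfU (by simp)).ne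
  have hlim := (ENNReal.Tendsto.mul (ha.add_const (wnorm 𝕜 H.wW 1 γ₀.1)) (Or.inr (by simp)) hb
    (Or.inr (by simpa using hA))).add
    (hc.add (ENNReal.Tendsto.mul_const ha (Or.inr hB)))
  simp only [mul_zero, zero_mul, add_zero] at hlim
  refine tendsto_of_tendsto_of_tendsto_of_le_of_le' tendsto_const_nhds hlim
    (Eventually.of_forall fun _ => zero_le) ?_
  have hev := (hη H.wU H.wU_mem 0 (by simp)).eventually_lt_const (ENNReal.ofReal_pos.2 hr)
  filter_upwards [hev, self_mem_nhdsWithin] with p hp hpΩ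
  have hcoe : (H.comp hm p - H.comp hm (γ₀, η₀)).1 =
      compFam p.1.1 p.2.1 - compFam γ₀.1 η₀.1 := by
    rw [← H.coe_comp hm γ₀ hη₀, ← H.coe_comp hm p.1 hpΩ.2]
    rfl
  rw [hcoe]
  exact H.wnorm_compFam_sub_le p.1.isFC γ₀.isFC hm' hball (H.mem_of_mem_Ω hη₀) hp f

/-- Two mean value inequalities: one for y ↦ γ(y) − Dγ(a + x)y, and one for Dγ to estimate the
derivative of that map. -/
lemma enorm_sub_sub_fderiv_le {γ : ∀ i, W i → Y i} (hγ : IsFC 𝕜 m γ) (hm : 1 + 1 ≤ m) {i : I}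
    (x : U i) {a v : X i} (hav : ∀ s ∈ Icc (0 : ℝ) 1, a + (s : 𝕜) • v ∈ V i) :
    ‖zeroExt (γ i) (a + v + x) - zeroExt (γ i) (a + x) - fderiv 𝕜 (zeroExt (γ i)) (a + x) v‖ₑ ≤
      wnorm 𝕜 H.wW 2 γ * ‖v‖ₑ * ‖v‖ₑ := by
  have hW : ∀ s ∈ Icc (0 : ℝ) 1, a + x + (s : 𝕜) • v ∈ W i := fun s hs => by
    rw [add_right_comm]
    exact H.add_coe_mem (hav s hs) x
  have hd : ∀ s ∈ Icc (0 : ℝ) 1,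
      DifferentiableAt 𝕜 (zeroExt (γ i)) (a + x + (s : 𝕜) • v) := fun s hs =>
    hγ.differentiableAt (le_self_add.trans hm) i ⟨_, hW s hs⟩
  have hW0 : a + x ∈ W i := by simpa using hW 0 (by simp)
  have key := enorm_sub_le_of_segment (𝕜 := 𝕜) (M := wnorm 𝕜 H.wW 2 γ * ‖v‖ₑ)
    (G := fun y => zeroExt (γ i) y - fderiv 𝕜 (zeroExt (γ i)) (a + x) y) (a := a + x) (v := v)
    (fun s hs => (hd s hs).sub (ContinuousLinearMap.differentiableAt _)) fun s hs => by
      rw [fderiv_fun_sub (hd s hs) (ContinuousLinearMap.differentiableAt _),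
        ContinuousLinearMap.fderiv]
      have hs' : ∀ s' ∈ Icc (0 : ℝ) 1, a + (s' : 𝕜) • (s : 𝕜) • v ∈ V i := fun s' hs' => by
        rw [smul_smul, ← RCLike.ofReal_mul]
        exact hav _ ⟨mul_nonneg hs'.1 hs.1, mul_le_one₀ hs'.2 hs.1 hs.2⟩
      have h := H.enorm_sub_le (hγ.derivFam hm) le_rfl x hs'
      rw [wnorm_derivFam, add_right_comm, zeroExt_of_mem _ (hW s hs), zeroExt_of_mem _ hW0] at h
      refine h.trans (mul_le_mul_right ?_ _)
      rw [← ofReal_norm, ← ofReal_norm]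
      refine ENNReal.ofReal_le_ofReal ?_
      rw [norm_smul, RCLike.norm_ofReal, abs_of_nonneg hs.1]
      exact mul_le_of_le_one_left (norm_nonneg _) hs.2
  rw [add_right_comm]
  refine le_trans (le_of_eq ?_) key
  rw [map_add]
  congr 1
  abel

/-- Pointwise evaluation of families of continuous linear maps. -/
abbrev eval : RProd 𝕜 U (fun i => X i →L[𝕜] Y i) H.𝒲U k →ₗ[𝕜] RProd 𝕜 U X H.𝒲U k →ₗ[𝕜]
    RProd 𝕜 U Y H.𝒲U k :=
  RProd.mul (fun i => ContinuousLinearMap.id 𝕜 (X i →L[𝕜] Y i))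
    (fun _ => ContinuousLinearMap.norm_id_le) H.wU_mem H.one_le_wU

/-- The error is an increment of γ₁ plus t⁻¹ times a second-order remainder of γ, both O(|t|). In
the quadratic term one factor η₁ is measured with f, the other with ω. -/
lemma wnorm_quotient_sub_le {γ γ₁ : RProd 𝕜 W Y 𝒲 m} (hm : 1 + 1 ≤ m) {η η₁ : ∀ i, U i → X i}
    {r : ℝ} (hη : ∀ (i : I) (x : U i),
      Metric.ball (η i x) (r / |restrictFun H.le ω ⟨i, x⟩|) ⊆ (V i : Set (X i)))
    (hηV : ∀ i x, η i x ∈ V i) {t : 𝕜} (ht : t ≠ 0)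
    (hr : wnorm 𝕜 H.wU 0 (t • η₁) < ENNReal.ofReal r) (f : (Σ i, W i) → WithTop ℝ) :
    wnorm 𝕜 (restrictFun H.le f) 0 (t⁻¹ • (compFam (γ + t • γ₁).1 (η + t • η₁) - compFam γ.1 η)
      - (compFam γ₁.1 η + fun i x => compFam (derivFam 𝕜 γ.1) η i x (η₁ i x))) ≤
      ‖t‖ₑ * (wnorm 𝕜 H.wW 1 γ₁.1 * wnorm 𝕜 (restrictFun H.le f) 0 η₁ +
        wnorm 𝕜 H.wW 2 γ.1 * wnorm 𝕜 H.wU 0 η₁ * wnorm 𝕜 (restrictFun H.le f) 0 η₁) := by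
  rw [wnorm_zero_eq]
  refine iSup₂_le fun i x => ?_
  have hseg : ∀ s ∈ Icc (0 : ℝ) 1, η i x + (s : 𝕜) • t • η₁ i x ∈ V i :=
    fun s hs => H.add_smul_mem hη hr i x hs
  have h1 := H.enorm_sub_le γ₁.isFC (le_self_add.trans hm) x hseg
  have h2 := H.enorm_sub_sub_fderiv_le γ.isFC hm x hseg
  set a : X i := η i x + x with ha
  set b : X i := η i x + t • η₁ i x + x with hb
  have haW : a ∈ W i := H.add_coe_mem (hηV i x) x
  have hbW : b ∈ W i := H.add_coe_mem (by simpa using hseg 1 (by simp)) x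
  have hsplit : (t⁻¹ • (compFam (γ + t • γ₁).1 (η + t • η₁) - compFam γ.1 η)
      - (compFam γ₁.1 η + fun i x => compFam (derivFam 𝕜 γ.1) η i x (η₁ i x))) i x =
      (zeroExt (γ₁.1 i) b - zeroExt (γ₁.1 i) a) +
        t⁻¹ • (zeroExt (γ.1 i) b - zeroExt (γ.1 i) a -
          fderiv 𝕜 (zeroExt (γ.1 i)) a (t • η₁ i x)) := by
    have e1 : compFam (γ + t • γ₁).1 (η + t • η₁) i x =
        zeroExt (γ.1 i) b + t • zeroExt (γ₁.1 i) b := by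
      change zeroExt (γ.1 i + t • γ₁.1 i) b = _
      rw [zeroExt_add, zeroExt_smul]
      rfl
    have e2 : compFam (derivFam 𝕜 γ.1) η i x = fderiv 𝕜 (zeroExt (γ.1 i)) a :=
      zeroExt_of_mem _ haW
    simp only [Pi.sub_apply, Pi.smul_apply, Pi.add_apply, e1, e2]
    simp only [compFam, ← ha, map_smul, smul_sub, smul_add, smul_smul, inv_mul_cancel₀ ht,
      one_smul]
    abel
  rw [hsplit]
  have h3 : ‖t⁻¹ • (zeroExt (γ.1 i) b - zeroExt (γ.1 i) a -
      fderiv 𝕜 (zeroExt (γ.1 i)) a (t • η₁ i x))‖ₑ ≤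
      wnorm 𝕜 H.wW 2 γ.1 * ‖η₁ i x‖ₑ * (‖t‖ₑ * ‖η₁ i x‖ₑ) := by
    rw [enorm_smul]
    refine (mul_le_mul_right h2 _).trans (le_of_eq ?_)
    have hc : ‖t⁻¹‖ₑ * ‖t‖ₑ = 1 := by
      rw [← enorm_mul, inv_mul_cancel₀ ht, enorm_one]
    rw [enorm_smul]
    calc _ = ‖t⁻¹‖ₑ * ‖t‖ₑ * (wnorm 𝕜 H.wW 2 γ.1 * ‖η₁ i x‖ₑ * (‖t‖ₑ * ‖η₁ i x‖ₑ)) := by ring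
      _ = _ := by rw [hc, one_mul]
  have h4 := mul_enorm_le_wnorm (𝕜 := 𝕜) (restrictFun H.le f) η₁ i x
  have h5 := enorm_le_wnorm_of_one_le (𝕜 := 𝕜) H.one_le_wU η₁ i x
  rw [enorm_smul] at h1
  calc _ ≤ wabs (restrictFun H.le f ⟨i, x⟩) * (wnorm 𝕜 H.wW 1 γ₁.1 * (‖t‖ₑ * ‖η₁ i x‖ₑ) +
        wnorm 𝕜 H.wW 2 γ.1 * ‖η₁ i x‖ₑ * (‖t‖ₑ * ‖η₁ i x‖ₑ)) := by
        gcongr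
        exact (enorm_add_le _ _).trans (add_le_add h1 h3)
    _ = ‖t‖ₑ * (wnorm 𝕜 H.wW 1 γ₁.1 * (wabs (restrictFun H.le f ⟨i, x⟩) * ‖η₁ i x‖ₑ) +
        wnorm 𝕜 H.wW 2 γ.1 * ‖η₁ i x‖ₑ * (wabs (restrictFun H.le f ⟨i, x⟩) * ‖η₁ i x‖ₑ)) := by
        ring
    _ ≤ _ := by gcongr

lemma tendsto_quotient_comp_zero {m' : ℕ∞} (hm : 0 + 1 ≤ m) (hm' : m' + 1 ≤ m)
    (hm'' : 0 + 1 ≤ m') (γ γ₁ : RProd 𝕜 W Y 𝒲 m) {η : RProd 𝕜 U X H.𝒲U 0} (hη : η ∈ H.Ω 0)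
    (η₁ : RProd 𝕜 U X H.𝒲U 0) :
    Tendsto (fun t : 𝕜 => t⁻¹ • (H.comp hm (γ + t • γ₁, η + t • η₁) - H.comp hm (γ, η)))
      (𝓝[≠] 0)
      (𝓝 (H.comp hm (γ₁, η) + H.eval (H.comp hm'' (RProd.deriv hm' γ, η)) η₁)) := by
  have hm2 : 1 + 1 ≤ m := le_trans (by gcongr; simpa using hm'') hm'
  refine RProd.tendsto_iff.2 ?_
  rintro _ ⟨f, hf, rfl⟩ j hj
  obtain rfl : j = 0 := by simpa using hj
  obtain ⟨r, hr, hball⟩ := id hη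
  have hfU : restrictFun H.le f ∈ H.𝒲U := ⟨f, hf, rfl⟩
  have hA : wnorm 𝕜 H.wW 1 γ₁.1 < ⊤ :=
    γ₁.wnorm_lt_top H.wW_mem (by exact_mod_cast le_self_add.trans hm2)
  have hB : wnorm 𝕜 H.wW 2 γ.1 < ⊤ := γ.wnorm_lt_top H.wW_mem (by exact_mod_cast hm2)
  have hC : wnorm 𝕜 (restrictFun H.le f) 0 η₁.1 < ⊤ := η₁.wnorm_lt_top hfU (by simp)
  have hD : wnorm 𝕜 H.wU 0 η₁.1 < ⊤ := η₁.wnorm_lt_top H.wU_mem (by simp)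
  have ht0 : Tendsto (fun t : 𝕜 => ‖t‖ₑ) (𝓝[≠] 0) (𝓝 0) := by
    have h : Tendsto (fun t : 𝕜 => ‖t‖ₑ) (𝓝 0) (𝓝 ‖(0 : 𝕜)‖ₑ) := continuous_enorm.tendsto 0
    rw [enorm_zero] at h
    exact h.mono_left nhdsWithin_le_nhds
  have hlim := ENNReal.Tendsto.mul_const (b := wnorm 𝕜 H.wW 1 γ₁.1 *
    wnorm 𝕜 (restrictFun H.le f) 0 η₁.1 + wnorm 𝕜 H.wW 2 γ.1 * wnorm 𝕜 H.wU 0 η₁.1 *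
    wnorm 𝕜 (restrictFun H.le f) 0 η₁.1) ht0 (Or.inr (ENNReal.add_lt_top.2
      ⟨ENNReal.mul_lt_top hA hC, ENNReal.mul_lt_top (ENNReal.mul_lt_top hB hD) hC⟩).ne)
  rw [zero_mul] at hlim
  refine tendsto_of_tendsto_of_tendsto_of_le_of_le' tendsto_const_nhds hlim
    (Eventually.of_forall fun _ => zero_le) ?_
  have hev : Tendsto (fun t : 𝕜 => wnorm 𝕜 H.wU 0 (t • η₁).1) (𝓝[≠] 0) (𝓝 0) := by
    have h := ENNReal.Tendsto.mul_const ht0 (Or.inr hD.ne)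
    rw [zero_mul] at h
    exact h.congr fun t => (wnorm_smul η₁.isFC t H.wU (by simp)).symm
  filter_upwards [hev.eventually_lt_const (ENNReal.ofReal_pos.2 hr), self_mem_nhdsWithin,
    eventually_add_smul_mem (H.isOpen_Ω 0) hη η₁] with t htr ht hΩ
  have hcoe : (t⁻¹ • (H.comp hm (γ + t • γ₁, η + t • η₁) - H.comp hm (γ, η)) -
      (H.comp hm (γ₁, η) + H.eval (H.comp hm'' (RProd.deriv hm' γ, η)) η₁)).1 =
      t⁻¹ • (compFam (γ + t • γ₁).1 (η.1 + t • η₁.1) - compFam γ.1 η.1)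
      - (compFam γ₁.1 η.1 + fun i x => compFam (derivFam 𝕜 γ.1) η.1 i x (η₁.1 i x)) := by
    have e1 : (H.comp hm (γ + t • γ₁, η + t • η₁)).1 =
      compFam (γ + t • γ₁).1 (η.1 + t • η₁.1) := H.coe_comp hm _ hΩ
    have e4 : (H.comp hm'' (RProd.deriv hm' γ, η)).1 = compFam (derivFam 𝕜 γ.1) η.1 :=
      H.coe_comp hm'' _ hη
    rw [← e1, ← e4, ← H.coe_comp hm γ hη, ← H.coe_comp hm γ₁ hη]
    rfl
  rw [hcoe]
  exact H.wnorm_quotient_sub_le hm2 hball (H.mem_of_mem_Ω hη) ht htr f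

lemma isOpen_univ_prod_Ω : IsOpen (univ ×ˢ H.Ω k : Set (RProd 𝕜 W Y 𝒲 m × _)) :=
  isOpen_univ.prod (H.isOpen_Ω k)

/-- The derivative of comp is comp precomposed with linear maps, plus an evaluation. Letting m' be
free avoids subtraction in ℕ∞: Dγ may be regarded in any C^m' with m' + 1 ≤ m. -/
lemma kellerCNat_comp_zero_succ {n : ℕ} (hm : 0 + 1 ≤ m) {m' : ℕ∞} (hm' : m' + 1 ≤ m)
    (hm'' : 0 + 1 ≤ m') (ih : KellerCNat 𝕜 n (H.comp (Y := Y) hm) (univ ×ˢ H.Ω 0))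
    (ih' : KellerCNat 𝕜 n (H.comp (Y := fun i => X i →L[𝕜] Y i) hm'') (univ ×ˢ H.Ω 0)) :
    KellerCNat 𝕜 (n + 1) (H.comp (Y := Y) hm) (univ ×ˢ H.Ω 0) := by
  let E := RProd 𝕜 W Y 𝒲 m × RProd 𝕜 U X H.𝒲U 0
  let p₁ := ContinuousLinearMap.fst 𝕜 E E
  let p₂ := ContinuousLinearMap.snd 𝕜 E E
  let q₁ := ContinuousLinearMap.fst 𝕜 (RProd 𝕜 W Y 𝒲 m) (RProd 𝕜 U X H.𝒲U 0)
  let q₂ := ContinuousLinearMap.snd 𝕜 (RProd 𝕜 W Y 𝒲 m) (RProd 𝕜 U X H.𝒲U 0)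
  have h1 := ih.comp_clm ((q₁.comp p₂).prod (q₂.comp p₁))
    (Q' := (univ ×ˢ H.Ω 0) ×ˢ univ) fun p hp => ⟨trivial, hp.1.2⟩
  have h2 := ih'.comp_clm (((RProd.deriv hm').comp (q₁.comp p₁)).prod (q₂.comp p₁))
    (Q' := (univ ×ˢ H.Ω 0) ×ˢ univ) fun p hp => ⟨trivial, hp.1.2⟩
  have h3 := ContinuousLinearMap.kellerCNat n (q₂.comp p₂) ((univ ×ˢ H.Ω 0) ×ˢ univ)
  have key := h1.add (KellerCNat.bilinear H.eval RProd.continuous_mul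
    (H.isOpen_univ_prod_Ω.prod isOpen_univ) h2 h3)
  refine ⟨H.continuousOn_comp_zero hm, _, ?_, key.continuousOn, key⟩
  rintro ⟨γ, η⟩ ⟨-, hη⟩ ⟨γ₁, η₁⟩
  exact H.tendsto_quotient_comp_zero hm hm' hm'' γ γ₁ hη η₁

/-- The induction replaces Y_i by L(X_i, Y_i), whose universe is max uX uY, so Y can only vary in
the induction if it starts there. `kellerCNat_comp_zero` handles any Y by invoking this lemma for
the derivative term. -/
lemma kellerCNat_comp_zero_max {n : ℕ} {Y : I → Type (max uX uY)} [∀ i, NormedAddCommGroup (Y i)]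
    [∀ i, NormedSpace 𝕜 (Y i)] {m : ℕ∞} (hm : 0 + 1 ≤ m) (hn : (n : ℕ∞) + 1 ≤ m) :
    KellerCNat 𝕜 n (H.comp (Y := Y) hm) (univ ×ˢ H.Ω 0) := by
  induction n generalizing Y m with
  | zero => exact H.continuousOn_comp_zero hm
  | succ n ih =>
    have hn' : ((n : ℕ∞) + 1) + 1 ≤ m := by exact_mod_cast hn
    have h0 : (0 : ℕ∞) + 1 ≤ n + 1 := by gcongr; simp
    exact H.kellerCNat_comp_zero_succ hm hn' h0 (ih hm (le_self_add.trans hn')) (ih h0 le_rfl)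

lemma kellerCNat_comp_zero {n : ℕ} (hm : 0 + 1 ≤ m) (hn : (n : ℕ∞) + 1 ≤ m) :
    KellerCNat 𝕜 n (H.comp (Y := Y) hm) (univ ×ˢ H.Ω 0) := by
  induction n with
  | zero => exact H.continuousOn_comp_zero hm
  | succ n ih =>
    have hn' : ((n : ℕ∞) + 1) + 1 ≤ m := by exact_mod_cast hn
    have h0 : (0 : ℕ∞) + 1 ≤ n + 1 := by gcongr; simp
    exact H.kellerCNat_comp_zero_succ hm hn' h0 (ih (le_self_add.trans hn'))
      (kellerCNat_comp_zero_max.{uI, uX, uY} H h0 le_rfl)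

end CompData

end Differentiability

namespace RProd

/-! ### Limits in weighted restricted products -/

section Closed

variable {𝕜 : Type*} [RCLike 𝕜] {I : Type*}
  {X : I → Type*} [∀ i, NormedAddCommGroup (X i)] [∀ i, NormedSpace 𝕜 (X i)]
  {U : ∀ i, TopologicalSpace.Opens (X i)}
  {Y : I → Type*} [∀ i, NormedAddCommGroup (Y i)] [∀ i, NormedSpace 𝕜 (Y i)]
  {𝒲 : Set ((Σ i, U i) → WithTop ℝ)} {k m : ℕ∞} {f₀ : (Σ i, U i) → WithTop ℝ}

lemma tendstoUniformlyOn_of_tendsto (hf₀ : f₀ ∈ 𝒲) (h₀ : ∀ p, 1 ≤ wabs (f₀ p)) {α : Type*}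
    {l : Filter α} {u : α → RProd 𝕜 U Y 𝒲 k} {φ : RProd 𝕜 U Y 𝒲 k} (h : Tendsto u l (𝓝 φ))
    (i : I) :
    TendstoUniformlyOn (fun a => zeroExt (u a i)) (zeroExt (φ i)) l (U i : Set (X i)) := by
  refine EMetric.tendstoUniformlyOn_iff.2 fun ε hε => ?_
  have hw := tendsto_iff.1 h f₀ hf₀ 0 (by simp)
  filter_upwards [hw.eventually_lt_const hε] with a ha x hx
  rw [edist_comm, edist_eq_enorm_sub, zeroExt_of_mem _ hx, zeroExt_of_mem _ hx]
  exact (enorm_le_wnorm_of_one_le h₀ (u a - φ).1 i ⟨x, hx⟩).trans_lt ha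

lemma tendsto_apply (hf₀ : f₀ ∈ 𝒲) (h₀ : ∀ p, 1 ≤ wabs (f₀ p)) {α : Type*}
    {l : Filter α} {u : α → RProd 𝕜 U Y 𝒲 k} {φ : RProd 𝕜 U Y 𝒲 k} (h : Tendsto u l (𝓝 φ))
    (i : I) (x : U i) : Tendsto (fun a => u a i x) l (𝓝 (φ i x)) := by
  simpa using (tendstoUniformlyOn_of_tendsto hf₀ h₀ h i).tendsto_at x.2

/-- If `u` converges in `C^0` and its derivatives converge in `C^k`, then the limit is in
`C^(k+1)`. -/
lemma exists_of_tendsto_deriv (hf₀ : f₀ ∈ 𝒲) (h₀ : ∀ p, 1 ≤ wabs (f₀ p)) {α : Type*}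
    {l : Filter α} [l.NeBot] {u : α → RProd 𝕜 U Y 𝒲 (k + 1)} {φ : RProd 𝕜 U Y 𝒲 0}
    {ψ : RProd 𝕜 U (fun i => X i →L[𝕜] Y i) 𝒲 k}
    (hφ : Tendsto (fun a => incl (by simp) (u a)) l (𝓝 φ))
    (hψ : Tendsto (fun a => deriv le_rfl (u a)) l (𝓝 ψ)) :
    ∃ z : RProd 𝕜 U Y 𝒲 (k + 1), incl (by simp) z = φ ∧ deriv le_rfl z = ψ := by
  have hd : ∀ (i : I) (x : U i), HasFDerivAt (zeroExt (φ i)) (ψ i x) (x : X i) := by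
    intro i x
    -- A weight of absolute value at least 1 makes both convergences uniform on U_i, so limit and
    -- derivative may be interchanged.
    have h := hasFDerivAt_of_tendstoUniformlyOn (𝕜 := 𝕜) (U i).isOpen
      (tendstoUniformlyOn_of_tendsto hf₀ h₀ hψ i) (f := fun a => zeroExt (u a i))
      (fun a y hy => by
        rw [zeroExt_of_mem _ hy, deriv_apply]
        exact ((u a).isFC.differentiableAt (by simp) i ⟨y, hy⟩).hasFDerivAt)
      (fun y hy => (tendstoUniformlyOn_of_tendsto hf₀ h₀ hφ i).tendsto_at hy) x.2
    rwa [zeroExt_coe] at h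
  have hfam : derivFam 𝕜 φ.1 = ψ.1 := funext fun i => funext fun x => (hd i x).fderiv
  have hFC : IsFC 𝕜 (k + 1) φ.1 := fun i => by
    have hcast : (((k + 1 : ℕ∞)) : WithTop ℕ∞) = (k : WithTop ℕ∞) + 1 := by push_cast; rfl
    rw [hcast, contDiffOn_succ_iff_fderiv_of_isOpen (U i).isOpen]
    refine ⟨fun x hx => (hd i ⟨x, hx⟩).differentiableAt.differentiableWithinAt, fun h => ?_,
      (ψ.isFC i).congr fun x hx => ?_⟩
    -- The analyticity clause is void, as k ∈ ℕ ∪ {∞}.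
    · exact absurd h (by simp)
    · rw [zeroExt_of_mem _ hx]
      exact (hd i ⟨x, hx⟩).fderiv
  refine ⟨⟨φ.1, hFC, fun f hf j hj => ?_⟩, rfl, Subtype.ext hfam⟩
  cases j with
  | zero => exact φ.wnorm_lt_top hf (by simp)
  | succ j =>
    rw [← wnorm_derivFam, hfam]
    refine ψ.wnorm_lt_top hf ?_
    rw [Nat.cast_succ] at hj
    exact (ENat.add_le_add_iff_right (by simp)).1 hj

/-- The seminorms of index 0 are controlled by φ in C^0, those of index j + 1 by Dφ in C^k. -/
lemma le_nhds_of_tendsto_deriv {l : Filter (RProd 𝕜 U Y 𝒲 (k + 1))} {φ : RProd 𝕜 U Y 𝒲 (k + 1)}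
    (h₀ : Tendsto (incl (k := 0) (by simp)) l (𝓝 (incl (by simp) φ)))
    (h₁ : Tendsto (deriv le_rfl) l (𝓝 (deriv le_rfl φ))) : l ≤ 𝓝 φ := by
  refine tendsto_id'.1 (tendsto_iff.2 fun f hf j hj => ?_)
  cases j with
  | zero => exact tendsto_iff.1 h₀ f hf 0 (by simp)
  | succ j =>
    rw [Nat.cast_succ] at hj
    refine (tendsto_iff.1 h₁ f hf j ((ENat.add_le_add_iff_right (by simp)).1 hj)).congr
      fun ψ => ?_
    rw [← map_sub]
    exact wnorm_derivFam f j (ψ - φ).1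

/-- The limits in the various C^n agree, being pointwise limits of the same family; their common
value lies in every C^n. -/
lemma exists_of_tendsto_incl (hf₀ : f₀ ∈ 𝒲) (h₀ : ∀ p, 1 ≤ wabs (f₀ p)) {α : Type*}
    {l : Filter α} [l.NeBot] {u : α → RProd 𝕜 U Y 𝒲 ⊤} {φ : ∀ n : ℕ, RProd 𝕜 U Y 𝒲 n}
    (h : ∀ n, Tendsto (fun a => incl le_top (u a)) l (𝓝 (φ n))) :
    ∃ z : RProd 𝕜 U Y 𝒲 ⊤, ∀ n, incl le_top z = φ n := by
  have heq : ∀ n, (φ n).1 = (φ 0).1 := fun n => funext fun i => funext fun x =>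
    tendsto_nhds_unique (tendsto_apply hf₀ h₀ (h n) i x) (tendsto_apply hf₀ h₀ (h 0) i x)
  refine ⟨⟨(φ 0).1, fun i => contDiffOn_infty.2 fun n => ?_, fun f hf j _ => ?_⟩,
    fun n => Subtype.ext (heq n).symm⟩
  · rw [← heq n]
    exact (φ n).isFC i
  · rw [← heq j]
    exact (φ j).wnorm_lt_top hf le_rfl

lemma le_nhds_of_tendsto_incl {l : Filter (RProd 𝕜 U Y 𝒲 ⊤)} {φ : RProd 𝕜 U Y 𝒲 ⊤}
    (h : ∀ n : ℕ, Tendsto (incl (k := n) le_top) l (𝓝 (incl le_top φ))) : l ≤ 𝓝 φ :=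
  tendsto_id'.1 (tendsto_iff.2 fun f hf j _ => tendsto_iff.1 (h j) f hf j le_rfl)

lemma kellerCNat_of_deriv (hf₀ : f₀ ∈ 𝒲) (h₀ : ∀ p, 1 ≤ wabs (f₀ p)) {n : ℕ} {E : Type*}
    [AddCommGroup E] [Module 𝕜 E] [TopologicalSpace E] [ContinuousAdd E] [ContinuousSMul 𝕜 E]
    {f : E → RProd 𝕜 U Y 𝒲 (k + 1)} {Q : Set E} (hQ : IsOpen Q)
    (h : KellerCNat 𝕜 n (fun p => incl (k := 0) (by simp) (f p)) Q)
    (h' : KellerCNat 𝕜 n (fun p => deriv le_rfl (f p)) Q) : KellerCNat 𝕜 n f Q := by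
  refine KellerCNat.of_inducing (ι := Unit)
    (fun _ => ((incl (k := 0) (by simp)).prod (deriv le_rfl)).toLinearMap)
    (fun l φ hl => le_nhds_of_tendsto_deriv (hl ()).fst_nhds (hl ()).snd_nhds)
    (fun u y hu => ?_) hQ fun _ => h.prodMk h'
  obtain ⟨z, hz₀, hz₁⟩ := exists_of_tendsto_deriv hf₀ h₀ (hu ()).fst_nhds (hu ()).snd_nhds
  exact ⟨z, fun _ => Prod.ext hz₀ hz₁⟩

lemma kellerCNat_of_incl (hf₀ : f₀ ∈ 𝒲) (h₀ : ∀ p, 1 ≤ wabs (f₀ p)) {n : ℕ} {E : Type*}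
    [AddCommGroup E] [Module 𝕜 E] [TopologicalSpace E] [ContinuousAdd E] [ContinuousSMul 𝕜 E]
    {f : E → RProd 𝕜 U Y 𝒲 ⊤} {Q : Set E} (hQ : IsOpen Q)
    (h : ∀ k : ℕ, KellerCNat 𝕜 n (fun p => incl (k := k) le_top (f p)) Q) :
    KellerCNat 𝕜 n f Q :=
  KellerCNat.of_inducing (G := fun k : ℕ => RProd 𝕜 U Y 𝒲 k)
    (fun _ => (incl le_top).toLinearMap) (fun _ _ hl => le_nhds_of_tendsto_incl hl)
    (fun _ _ hu => exists_of_tendsto_incl hf₀ h₀ hu) hQ h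

end Closed

end RProd

section Smoothness

namespace CompData

universe uI uX uY

variable {𝕜 : Type*} [RCLike 𝕜] {I : Type uI}
  {X : I → Type uX} [∀ i, NormedAddCommGroup (X i)] [∀ i, NormedSpace 𝕜 (X i)]
  {Y : I → Type uY} [∀ i, NormedAddCommGroup (Y i)] [∀ i, NormedSpace 𝕜 (Y i)]
  {U V W : ∀ i, TopologicalSpace.Opens (X i)} {𝒲 : Set ((Σ i, W i) → WithTop ℝ)}
  {ω : (Σ i, W i) → ℝ} (H : CompData 𝕜 U V W 𝒲 ω) {k m : ℕ∞}

/-! ### Composition is of class `C^ℓ` -/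

/-- Pointwise composition of families of continuous linear maps. -/
abbrev mulComp : RProd 𝕜 U (fun i => X i →L[𝕜] Y i) H.𝒲U k →ₗ[𝕜]
    RProd 𝕜 U (fun i => X i →L[𝕜] X i) H.𝒲U k →ₗ[𝕜] RProd 𝕜 U (fun i => X i →L[𝕜] Y i) H.𝒲U k :=
  RProd.mul (fun i => ContinuousLinearMap.compL 𝕜 (X i) (X i) (Y i))
    (fun _ => ContinuousLinearMap.norm_compL_le _ _ _ _) H.wU_mem H.one_le_wU

/-- Chain rule with D(η + id) = Dη + id. The constant family id may have infinite weighted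
seminorms, so its term stands apart instead of entering the product. -/
lemma deriv_comp {m' : ℕ∞} (hm : k + 1 + 1 ≤ m) (hm' : m' + 1 ≤ m) (hm'' : k + 1 ≤ m')
    (γ : RProd 𝕜 W Y 𝒲 m) {η : RProd 𝕜 U X H.𝒲U (k + 1)} (hη : η ∈ H.Ω (k + 1)) :
    RProd.deriv le_rfl (H.comp hm (γ, η)) =
      H.mulComp (H.comp hm'' (RProd.deriv hm' γ, RProd.incl (by simp) η))
        (RProd.deriv le_rfl η) +
      H.comp hm'' (RProd.deriv hm' γ, RProd.incl (by simp) η) := by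
  ext1 i x
  have hη' : RProd.incl (k := k) (by simp) η ∈ H.Ω k := hη
  have hW := H.add_coe_mem (H.mem_of_mem_Ω hη i x) x
  have e1 : H.comp hm'' (RProd.deriv hm' γ, RProd.incl (by simp) η) i x =
      fderiv 𝕜 (zeroExt (γ i)) (η i x + x) :=
    (H.comp_apply hm'' _ hη' i x).trans (zeroExt_of_mem _ hW)
  have e2 : zeroExt (H.comp hm (γ, η) i) =ᶠ[𝓝 (x : X i)]
      zeroExt (γ.1 i) ∘ fun y => zeroExt (η.1 i) y + y := by
    have h : H.comp hm (γ, η) i = compFam γ.1 η.1 i := congrFun (H.coe_comp hm γ hη) i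
    rw [h]
    exact (zeroExt_compFam_eqOn γ.1 η.1 i).eventuallyEq_of_mem ((U i).isOpen.mem_nhds x.2)
  have dη : DifferentiableAt 𝕜 (zeroExt (η.1 i)) (x : X i) :=
    η.isFC.differentiableAt (by simp) i x
  have dγ : DifferentiableAt 𝕜 (zeroExt (γ.1 i)) (zeroExt (η.1 i) (x : X i) + x) := by
    rw [zeroExt_coe]
    exact γ.isFC.differentiableAt (le_trans (by simp) hm) i ⟨_, hW⟩
  have e3 : fderiv 𝕜 (zeroExt (γ.1 i) ∘ fun y => zeroExt (η.1 i) y + y) (x : X i) =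
      (fderiv 𝕜 (zeroExt (γ.1 i)) (η.1 i x + x)).comp
        (fderiv 𝕜 (zeroExt (η.1 i)) x + ContinuousLinearMap.id 𝕜 (X i)) := by
    rw [fderiv_comp (f := fun y => zeroExt (η.1 i) y + y) _ dγ (dη.fun_add differentiableAt_fun_id), zeroExt_coe,
      fderiv_fun_add dη differentiableAt_fun_id, fderiv_fun_id]
  rw [RProd.deriv_apply, RProd.add_apply, RProd.mul_apply, e1, e2.fderiv_eq, e3,
    ContinuousLinearMap.comp_add, ContinuousLinearMap.comp_id]
  rfl

/-- The component in C^0 is the case k = 0 restricted along an inclusion; the component in C^k is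
given by `deriv_comp`. -/
lemma kellerCNat_comp_succ {n : ℕ} {m' : ℕ∞} (hm : k + 1 + 1 ≤ m) (hm₀ : 0 + 1 ≤ m)
    (hm' : m' + 1 ≤ m) (hm'' : k + 1 ≤ m')
    (ih₀ : KellerCNat 𝕜 n (H.comp (Y := Y) hm₀) (univ ×ˢ H.Ω 0))
    (ih : KellerCNat 𝕜 n (H.comp (Y := fun i => X i →L[𝕜] Y i) hm'') (univ ×ˢ H.Ω k)) :
    KellerCNat 𝕜 n (H.comp (Y := Y) hm) (univ ×ˢ H.Ω (k + 1)) := by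
  have hQ : IsOpen (univ ×ˢ H.Ω (k + 1) : Set (RProd 𝕜 W Y 𝒲 m × _)) := H.isOpen_univ_prod_Ω
  let q₁ := ContinuousLinearMap.fst 𝕜 (RProd 𝕜 W Y 𝒲 m) (RProd 𝕜 U X H.𝒲U (k + 1))
  let q₂ := ContinuousLinearMap.snd 𝕜 (RProd 𝕜 W Y 𝒲 m) (RProd 𝕜 U X H.𝒲U (k + 1))
  refine RProd.kellerCNat_of_deriv H.wU_mem H.one_le_wU hQ ?_ ?_
  · refine (ih₀.comp_clm (q₁.prod ((RProd.incl (by simp)).comp q₂))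
      (Q' := univ ×ˢ H.Ω (k + 1)) fun p hp => ⟨trivial, hp.2⟩).congr hQ ?_
    rintro ⟨γ, η⟩ ⟨-, hη⟩
    have hη' : RProd.incl (k := 0) (by simp) η ∈ H.Ω 0 := hη
    exact Subtype.ext ((H.coe_comp hm γ hη).trans (H.coe_comp hm₀ γ hη').symm)
  · have h1 := ih.comp_clm (((RProd.deriv hm').comp q₁).prod ((RProd.incl (by simp)).comp q₂))
      (Q' := univ ×ˢ H.Ω (k + 1)) fun p hp => ⟨trivial, hp.2⟩
    have h2 := ContinuousLinearMap.kellerCNat n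
      ((RProd.deriv (𝕜 := 𝕜) (Y := X) (k := k) le_rfl).comp q₂) (univ ×ˢ H.Ω (k + 1))
    refine ((KellerCNat.bilinear H.mulComp RProd.continuous_mul hQ h1 h2).add h1).congr hQ ?_
    rintro ⟨γ, η⟩ ⟨-, hη⟩
    exact H.deriv_comp hm hm' hm'' γ hη

/-- The universe of Y is restricted for the same reason as in `kellerCNat_comp_zero_max`: the
induction on k also passes to L(X_i, Y_i). -/
lemma kellerCNat_comp_nat_max {n : ℕ} (k : ℕ) {Y : I → Type (max uX uY)}
    [∀ i, NormedAddCommGroup (Y i)] [∀ i, NormedSpace 𝕜 (Y i)] {m : ℕ∞} (hm : (k : ℕ∞) + 1 ≤ m)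
    (hn : (k : ℕ∞) + n + 1 ≤ m) : KellerCNat 𝕜 n (H.comp (Y := Y) hm) (univ ×ˢ H.Ω k) := by
  induction k generalizing Y m with
  | zero => exact H.kellerCNat_comp_zero hm (by simpa using hn)
  | succ k ih =>
    have hn' : ((k : ℕ∞) + n + 1) + 1 ≤ m := by
      refine le_trans (le_of_eq ?_) hn
      push_cast
      ring
    have h1 : (k : ℕ∞) + 1 ≤ k + n + 1 := by gcongr; exact le_self_add
    have h0 : (n : ℕ∞) + 1 ≤ m := le_trans (by gcongr; exact le_add_self) hn
    exact H.kellerCNat_comp_succ hm _ hn' h1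
      (H.kellerCNat_comp_zero (le_trans (by gcongr; simp) h0) h0) (ih h1 le_rfl)

lemma kellerCNat_comp_nat {n : ℕ} (k : ℕ) {m : ℕ∞} (hm : (k : ℕ∞) + 1 ≤ m)
    (hn : (k : ℕ∞) + n + 1 ≤ m) : KellerCNat 𝕜 n (H.comp (Y := Y) hm) (univ ×ˢ H.Ω k) := by
  cases k with
  | zero => exact H.kellerCNat_comp_zero hm (by simpa using hn)
  | succ k =>
    have hn' : ((k : ℕ∞) + n + 1) + 1 ≤ m := by
      refine le_trans (le_of_eq ?_) hn
      push_cast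
      ring
    have h1 : (k : ℕ∞) + 1 ≤ k + n + 1 := by gcongr; exact le_self_add
    have h0 : (n : ℕ∞) + 1 ≤ m := le_trans (by gcongr; exact le_add_self) hn
    exact H.kellerCNat_comp_succ hm _ hn' h1
      (H.kellerCNat_comp_zero (le_trans (by gcongr; simp) h0) h0)
      (kellerCNat_comp_nat_max.{uI, uX, uY} H k h1 le_rfl)

lemma kellerCNat_comp_top {n : ℕ} (hm : ⊤ + 1 ≤ m) :
    KellerCNat 𝕜 n (H.comp (Y := Y) hm) (univ ×ˢ H.Ω ⊤) := by
  have hQ : IsOpen (univ ×ˢ H.Ω ⊤ : Set (RProd 𝕜 W Y 𝒲 m × _)) := H.isOpen_univ_prod_Ω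
  have hm' : ∀ a : ℕ∞, a ≤ m := fun a => le_top.trans (le_self_add.trans hm)
  let q₁ := ContinuousLinearMap.fst 𝕜 (RProd 𝕜 W Y 𝒲 m) (RProd 𝕜 U X H.𝒲U ⊤)
  let q₂ := ContinuousLinearMap.snd 𝕜 (RProd 𝕜 W Y 𝒲 m) (RProd 𝕜 U X H.𝒲U ⊤)
  refine RProd.kellerCNat_of_incl H.wU_mem H.one_le_wU hQ fun k => ?_
  refine ((H.kellerCNat_comp_nat k (hm' _) (hm' _)).comp_clm
    (q₁.prod ((RProd.incl le_top).comp q₂))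
    (Q' := univ ×ˢ H.Ω ⊤) fun p hp => ⟨trivial, hp.2⟩).congr hQ ?_
  rintro ⟨γ, η⟩ ⟨-, hη⟩
  have hη' : RProd.incl (k := k) le_top η ∈ H.Ω k := hη
  exact Subtype.ext ((H.coe_comp hm γ hη).trans (H.coe_comp (hm' _) γ hη').symm)

lemma kellerC_comp {ℓ : ℕ∞} (hm : k + 1 ≤ m) (hℓ : k + ℓ + 1 ≤ m) :
    KellerC 𝕜 ℓ (H.comp (Y := Y) hm) (univ ×ˢ H.Ω k) := fun n hn => by
  cases k with
  | top => exact H.kellerCNat_comp_top hm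
  | coe k => exact H.kellerCNat_comp_nat k hm (le_trans (by gcongr) hℓ)

end CompData

end Smoothness

/-! ### Adjusting weights -/

/-- The ball is connected, meets S in 0 and misses the frontier of S, hence cannot leave S. -/
lemma ball_subset_of_le_infEDist_frontier (𝕜 : Type*) [RCLike 𝕜] {A : Type*}
    [NormedAddCommGroup A] [NormedSpace 𝕜 A] {S : Set A} (hS : IsOpen S) (h0 : (0 : A) ∈ S) {r : ℝ}
    (hr : ENNReal.ofReal r ≤ Metric.infEDist (0 : A) (frontier S)) : Metric.ball 0 r ⊆ S := by
  let _ : NormedSpace ℝ A := NormedSpace.restrictScalars ℝ 𝕜 A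
  rcases le_or_gt r 0 with hr0 | hr0
  · simp [Metric.ball_eq_empty.2 hr0]
  refine (convex_ball (0 : A) r).isPreconnected.subset_of_closure_inter_subset hS
    ⟨0, Metric.mem_ball_self hr0, h0⟩ fun y hy => ?_
  by_contra hyS
  have hyf : y ∈ frontier S := ⟨hy.1, by rwa [hS.interior_eq]⟩
  have h1 : edist 0 y < ENNReal.ofReal r := by
    rw [edist_dist, ENNReal.ofReal_lt_ofReal_iff hr0, dist_comm]
    exact hy.2
  exact absurd (hr.trans (Metric.infEDist_le_edist_of_mem hyf)) (not_le.2 h1)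

end WeightedProd

end

/-! ### Conclusion -/

theorem mainTheorem2 {𝕜 : Type*} [RCLike 𝕜] {I : Type*} [Nonempty I]
    {X : I → Type*} [∀ i, NormedAddCommGroup (X i)] [∀ i, NormedSpace 𝕜 (X i)]
    {Y : I → Type*} [∀ i, NormedAddCommGroup (Y i)] [∀ i, NormedSpace 𝕜 (Y i)]
    (U V W : ∀ i, TopologicalSpace.Opens (X i))
    (hU : ∀ i, (U i : Set (X i)).Nonempty)
    (hV : ∀ i, (V i : Set (X i)).Nonempty)
    (hUVW : ∀ i, ∀ x ∈ U i, ∀ v ∈ V i, x + v ∈ W i)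
    (hbal : ∀ i, Balanced 𝕜 (V i : Set (X i)))
    (𝒲 : Set ((Σ i, W i) → WithTop ℝ))
    (ω : (Σ i, W i) → ℝ)
    (hω : (fun p => (ω p : WithTop ℝ)) ∈ 𝒲)
    (hadj : WeightedProd.IsAdjustingWeightFor ω (fun i => (V i : Set (X i))))
    (k ℓ : ℕ∞) :
    let hUW : ∀ i, U i ≤ W i := WeightedProd.le_of_add_subset hV hbal hUVW
    let 𝒲U : Set ((Σ i, U i) → WithTop ℝ) := WeightedProd.restrictFun hUW '' 𝒲
    let Ω : Set (WeightedProd.RProd 𝕜 U X 𝒲U k) :=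
      WeightedProd.omegaSet X (fun i => (V i : Set (X i))) (WeightedProd.restrictFun hUW ω)
    IsOpen Ω ∧ Ω.Nonempty ∧
    ∃ Φ : WeightedProd.RProd 𝕜 W Y 𝒲 (k + ℓ + 1) ×
        WeightedProd.RProd 𝕜 U X 𝒲U k → WeightedProd.RProd 𝕜 U Y 𝒲U k,
      (∀ γ : WeightedProd.RProd 𝕜 W Y 𝒲 (k + ℓ + 1), ∀ η ∈ Ω,
        ∀ (i : I) (x : U i), ∃ h : η i x + (x : X i) ∈ W i,
          Φ (γ, η) i x = γ i ⟨η i x + (x : X i), h⟩) ∧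
      WeightedProd.KellerC 𝕜 ℓ Φ (univ ×ˢ Ω) := by
  intro hUW 𝒲U Ω
  have hω' : ∀ p : Σ i, W i,
      (Metric.infEDist (0 : X p.1) (frontier (V p.1 : Set (X p.1))))⁻¹ ≤ ‖ω p‖ₑ ∧ 1 ≤ ‖ω p‖ₑ :=
    fun p => max_le_iff.1 (((hadj p.1).2).trans (iInf_le _ p.2))
  have H : WeightedProd.CompData 𝕜 U V W 𝒲 ω :=
    { le := hUW
      add_mem := hUVW
      nonempty := hV
      balanced := hbal
      mem := hω
      one_le := fun p => by
        have h := (hω' p).2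
        rwa [← ofReal_norm, ENNReal.one_le_ofReal, Real.norm_eq_abs] at h }
  -- The zero family lies in Ω with r = 1, since inverting 1 / dist(0, ∂V_i) ≤ |ω(x)| gives 1 /
  -- |ω(x)| ≤ dist(0, ∂V_i).
  refine ⟨H.isOpen_Ω k, ⟨0, 1, one_pos, fun i x => ?_⟩, H.comp ?_, ?_, ?_⟩
  · refine WeightedProd.ball_subset_of_le_infEDist_frontier 𝕜 (V i).isOpen (H.zero_mem i) ?_
    have h := ENNReal.inv_le_iff_inv_le.1 (hω' ⟨i, ⟨x, hUW i x.2⟩⟩).1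
    refine le_trans (le_of_eq ?_) h
    rw [← ofReal_norm, Real.norm_eq_abs, ← ENNReal.ofReal_inv_of_pos (H.pos _), one_div]
    rfl
  · gcongr
    exact le_self_add
  · intro γ η hη i x
    have h := H.add_coe_mem (H.mem_of_mem_Ω hη i x) x
    exact ⟨h, (H.comp_apply _ γ hη i x).trans (WeightedProd.zeroExt_of_mem _ h)⟩
  · exact H.kellerC_comp _ le_rfl
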